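/- Let $d\ge 2$, let $Q$ be a nondegenerate indefinite quadratic form in $d+1$ variables with rational coefficients, and let $m\ne 0$ be rational. On $\mathbb R^{d+1}$ let $\|\cdot\|$ be the sup norm and $\|\cdot\|_2$ the Euclidean norm. Put $C^d=\{x\in\mathbb R^{d+1}:\|x\|=1\}$, $\mathfrak p(x)=x/\|x\|$ for $x\neq 0$, $\partial X=\{x\in C^d: Q(x)=0\}$ with the metric induced by $\|\cdot\|_2$, and $X_m(\mathbb Z)=\{x\in\mathbb Z^{d+1}:Q(x)=m\}$. Let $BA$ be the set of $v\in\partial X$ for which there is $c>0$ with $$\|\mathfrak p(x)-v\|\ \ge\ c\,\|x\|^{-1}\qquad\text{for all }x\in X_m(\mathbb Z)\setminus\{0\}.$$ Games. In a complete metric space, Players B and A alternately choose closed balls (with chosen centres, and chosen radii $\rho>0$) $B_1\supseteq A_1\supseteq B_2\supseteq A_2\supseteq\cdots$. In the $(\alpha,\beta)$-game ($0<\alpha,\beta<1$) it is required that $\rho(A_n)=\alpha\rho(B_n)$ and $\rho(B_{n+1})=\beta\rho(A_n)$. In the strong $(\alpha,\beta)$-game it is required that $\alpha\rho(B_n)\le\rho(A_n)\le\rho(B_n)$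 and $\beta\rho(A_n)\le\rho(B_{n+1})\le\rho(A_n)$. Player A wins for the target set $S$ if $\bigcap_n B_n\subseteq S$. The set $S$ is $\alpha$-winning (respectively $\alpha$-strong winning) if $0<\alpha<1$ and, for every $\beta\in(0,1)$, Player A has a winning strategy in the $(\alpha,\beta)$-game (respectively in the strong one). Constants. The bilipschitz constant of a map $f$ on a set is the least $c\ge1$ with $c^{-1}\|x-y\|_2\le\|f(x)-f(y)\|_2\le c\|x-y\|_2$ for all $x,y$ in the set. Let $c_\pi$ be the bilipschitz constant of the radial projection $x\mapsto x/x_0$ on $\{x\in C^d: |x_0-1|\le\tfrac12\}$ (the thickened face), where $x_0$ is the first coordinate; it depends only on $d$. For $M\in GL_{d+1}(\mathbb Q)$ let $c_M$ be the bilipschitz constant of $x\mapsto\mathfrak p(Mx)$ on $C^d$. Then: 1. If $Q$ is diagonal, then $BA$ is $\alpha$-strong winning and $\alpha$-winning in $\partial X$ with $\alpha=\dfrac1{8c_\pi^2}$. 2. For general $Q$, there exists $M\in GL_{d+1}(\mathbb Q)$ such that $x\mapsto Q(Mx)$ is diagonal, and for every such $M$ the set $BA$ is $\alpha$-strong winning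 and $\alpha$-winning in $\partial X$ with $\alpha=\dfrac1{8c_M^2c_\pi^2}$. -/

import Mathlib

noncomputable section

namespace BadApprox

/-! ### Schmidt games on a metric space -/

/-- A closed ball of `M` with a chosen centre and a chosen positive radius. -/
structure CBall (M : Type*) where
  center : M
  radius : ℝ
  radius_pos : 0 < radius

/-- The set of points of a closed ball. -/
def CBall.carrier {M : Type*} [MetricSpace M] (W : CBall M) : Set M :=
  Metric.closedBall W.center W.radius

/-- Radius rule of Schmidt's game: the new radius is exactly `γ` times the previous one. -/
def schmidtRule (γ old new : ℝ) : Prop := new = γ * old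

/-- Radius rule of the strong game: the new radius is at least `γ` times the previous one.
As always for nested balls with chosen radii, the radius never increases (in a Euclidean space
this follows from the inclusion of the balls). -/
def strongRule (γ old new : ℝ) : Prop := γ * old ≤ new ∧ new ≤ old

/-- `V` is a legal answer to the ball `W`, with parameter `γ`. -/
def IsMove {M : Type*} [MetricSpace M] (rule : ℝ → ℝ → ℝ → Prop) (γ : ℝ) (W V : CBall M) :
    Prop :=
  V.carrier ⊆ W.carrier ∧ rule γ W.radius V.radius

/-- A strategy of Player A: the answer to the balls `B 0, …, B n` chosen so far by Player B
(the earlier balls of Player A are determined by these and the strategy). -/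
abbrev Strategy (M : Type*) := (n : ℕ) → (Fin (n + 1) → CBall M) → CBall M

/-- The `n`-th ball of Player A when A follows `σ` against the balls `B`. -/
def Strategy.reply {M : Type*} (σ : Strategy M) (B : ℕ → CBall M) (n : ℕ) : CBall M :=
  σ n fun i => B i

/-- Player A has a strategy that wins the `(α, β)`-game for the target set `S`: as long as
Player B has moved legally, the answers of the strategy are legal, and if all moves of Player B
are legal, then the intersection of the balls lies in `S`. -/
def IsGameWinning {M : Type*} [MetricSpace M] (rule : ℝ → ℝ → ℝ → Prop) (α β : ℝ)
    (S : Set M) : Prop :=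
  ∃ σ : Strategy M, ∀ B : ℕ → CBall M,
    (∀ n, (∀ k < n, IsMove rule β (σ.reply B k) (B (k + 1))) →
      IsMove rule α (B n) (σ.reply B n)) ∧
    ((∀ n, IsMove rule β (σ.reply B n) (B (n + 1))) → (⋂ n, (B n).carrier) ⊆ S)

/-- `S` is `α`-winning. -/
def IsWinning {M : Type*} [MetricSpace M] (α : ℝ) (S : Set M) : Prop :=
  0 < α ∧ α < 1 ∧ ∀ β : ℝ, 0 < β → β < 1 → IsGameWinning schmidtRule α β S

/-- `S` is `α`-strong winning. -/
def IsStrongWinning {M : Type*} [MetricSpace M] (α : ℝ) (S : Set M) : Prop :=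
  0 < α ∧ α < 1 ∧ ∀ β : ℝ, 0 < β → β < 1 → IsGameWinning strongRule α β S

/-! ### The unit cube, quadratic varieties, badly approximable vectors -/

/-- `ℝ^(d+1)` with its Euclidean distance. -/
abbrev Space (d : ℕ) := EuclideanSpace ℝ (Fin (d + 1))

/-- The sup norm on `ℝ^(d+1)`. -/
def supNorm {d : ℕ} (x : Space d) : ℝ := ‖WithLp.ofLp x‖

/-- The unit `d`-cube `C^d`, that is, the unit sphere of the sup norm. -/
def cube (d : ℕ) : Set (Space d) := {x | supNorm x = 1}

/-- Radial projection of the nonzero vectors onto the cube. -/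
def radial {d : ℕ} (x : Space d) : Space d := (supNorm x)⁻¹ • x

/-- An integer vector as a point of `ℝ^(d+1)`. -/
def intVec {d : ℕ} (x : Fin (d + 1) → ℤ) : Space d := WithLp.toLp 2 fun i => (x i : ℝ)

/-- The real quadratic form with the same (rational) coefficients as `Q`. -/
def realForm {d : ℕ} (Q : QuadraticForm ℚ (Fin (d + 1) → ℚ)) :
    QuadraticForm ℝ (Fin (d + 1) → ℝ) :=
  (Q.toMatrix'.map (algebraMap ℚ ℝ)).toQuadraticForm'

/-- `∂X`, the light-cone `Q = 0` intersected with the cube. -/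
def boundary {d : ℕ} (Q : QuadraticForm ℚ (Fin (d + 1) → ℚ)) : Set (Space d) :=
  {x | realForm Q (WithLp.ofLp x) = 0} ∩ cube d

/-- `X_m(ℤ)`, the integer points of the variety `Q = m`. -/
def intPoints {d : ℕ} (Q : QuadraticForm ℚ (Fin (d + 1) → ℚ)) (m : ℚ) :
    Set (Fin (d + 1) → ℤ) :=
  {x | Q (fun i => (x i : ℚ)) = m}

/-- The badly `(Z, ψ)`-approximable vectors of `∂X`, as a subset of the metric space `∂X`
(with the Euclidean distance). -/
def BA {d : ℕ} (Q : QuadraticForm ℚ (Fin (d + 1) → ℚ)) (ψ : ℝ → ℝ)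
    (Z : Set (Fin (d + 1) → ℤ)) : Set (boundary Q) :=
  {v | ∃ c : ℝ, 0 < c ∧ ∀ x ∈ Z, x ≠ 0 →
    c * ψ (supNorm (intVec x)) ≤ supNorm (radial (intVec x) - (v : Space d))}

/-! ### The constant `α` -/

/-- The (smallest) bilipschitz constant `≥ 1` of `f` on `s`, for the Euclidean distance. -/
def bilipConst {d : ℕ} (f : Space d → Space d) (s : Set (Space d)) : ℝ :=
  sInf {c | 1 ≤ c ∧ ∀ x ∈ s, ∀ y ∈ s,
    c⁻¹ * dist x y ≤ dist (f x) (f y) ∧ dist (f x) (f y) ≤ c * dist x y}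

/-- The part of the cube within distance `1/2` of the affine hyperplane `x₀ = 1` that contains
the face `x₀ = 1`. -/
def thickFace (d : ℕ) : Set (Space d) := {x | x ∈ cube d ∧ |x 0 - 1| ≤ 1 / 2}

/-- `c_π`: the bilipschitz constant of the radial projection `x ↦ x / x₀` of the thickened face
onto the affine hyperplane `x₀ = 1`. -/
def cPi (d : ℕ) : ℝ := bilipConst (fun x => (x 0)⁻¹ • x) (thickFace d)

/-- `c_M`: the bilipschitz constant of the map of the cube to itself induced by `M`. -/
def cMat {d : ℕ} (M : GL (Fin (d + 1)) ℚ) : ℝ :=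
  bilipConst
    (fun x => radial (WithLp.toLp 2 ((M.val.map (algebraMap ℚ ℝ)).mulVec (WithLp.ofLp x))))
    (cube d)

/-- The quadratic form `Q` has no mixed terms. -/
def IsDiagonal {d : ℕ} (Q : QuadraticForm ℚ (Fin (d + 1) → ℚ)) : Prop := Q.toMatrix'.IsDiag

/-- The linear change of variables `M` turns `Q` into the diagonal form `x ↦ Q (M x)`. -/
def Diagonalizes {d : ℕ} (M : GL (Fin (d + 1)) ℚ) (Q : QuadraticForm ℚ (Fin (d + 1) → ℚ)) :
    Prop :=
  IsDiagonal (Q.comp (Matrix.toLin' M.val))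

end BadApprox

end

namespace BadApprox

open scoped RealInnerProductSpace

variable {d : ℕ}

/-! ### The sup norm and radial projection -/

/-! Let ρ be the radius and v the centre of Player B's current ball, γ = αβ, and h(x) the sup norm
of an integer vector x. The bilinear form b of Q takes values in (1/N)ℤ at integer vectors, so
values smaller than 1/N vanish.

Rigidity. Isotropic integer vectors of height at most ε/ρ with direction within 2ρ of v are pairwise
orthogonal (`exists_isotropic_orthogonal`), hence span a totally isotropic space, of dimension at
most (d+1)/2. As d ≥ 2, some direction tangent to the cone at v is, as a functional, constant on all
of them in an affine chart (`exists_tangent`). A step along it, corrected to stay on the cone,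
avoids them all. If x, y on Q = m are close to v and of nearly equal height, then b(x, y) = m, so x
- y is isotropic; since the play avoids isotropic vectors, x = y (`exists_separation`). Thus only
boundedly many points of Q = m enter per round.

Potential. Those points need not be avoidable all at once, but there are two admissible moves more
than 6αρ apart (`exists_two_moves`), and one of them keeps at most half of any given weight
(`exists_avoiding_move`). Give x the weight (ρ h(x))^(-s) with γ^(-s) ≤ 3/2. The total weight Φ of
the points threatening the ball satisfies Φ' ≤ (3/4)Φ + E, so it stays bounded. A point
approximating the limit too well would at some stage have a weight exceeding the bound
(`exists_pos_le_of_play`).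

The argument works for a general form and every positive α ≤ 1/(8 c_π²); the constant in part 2 is
covered because c_M ≥ 1. -/

theorem supNorm_nonneg (x : Space d) : 0 ≤ supNorm x := norm_nonneg _

theorem supNorm_add_le (x y : Space d) : supNorm (x + y) ≤ supNorm x + supNorm y :=
  norm_add_le (WithLp.ofLp x) (WithLp.ofLp y)

theorem supNorm_smul (a : ℝ) (x : Space d) : supNorm (a • x) = |a| * supNorm x := by
  have h := norm_smul a (WithLp.ofLp x)
  rwa [Real.norm_eq_abs] at h

theorem abs_apply_le_supNorm (x : Space d) (i : Fin (d + 1)) : |x i| ≤ supNorm x :=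
  norm_le_pi_norm (WithLp.ofLp x) i

theorem supNorm_le_iff {x : Space d} {r : ℝ} (hr : 0 ≤ r) : supNorm x ≤ r ↔ ∀ i, |x i| ≤ r :=
  pi_norm_le_iff_of_nonneg hr

theorem abs_supNorm_sub_le (x y : Space d) : |supNorm x - supNorm y| ≤ supNorm (x - y) :=
  abs_norm_sub_norm_le (WithLp.ofLp x) (WithLp.ofLp y)

theorem exists_abs_apply_eq_supNorm (x : Space d) : ∃ i, |x i| = supNorm x := by
  obtain ⟨i, hi⟩ := Finite.exists_max fun i => |x i|
  exact ⟨i, le_antisymm (abs_apply_le_supNorm x i)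
    ((supNorm_le_iff (abs_nonneg _)).2 hi)⟩

theorem abs_apply_le_norm (x : Space d) (i : Fin (d + 1)) : |x i| ≤ ‖x‖ :=
  PiLp.norm_apply_le x i

theorem supNorm_le_norm (x : Space d) : supNorm x ≤ ‖x‖ :=
  (supNorm_le_iff (norm_nonneg _)).2 (abs_apply_le_norm x)

theorem norm_le_supNorm (x : Space d) : ‖x‖ ≤ (d + 1) * supNorm x := by
  have h0 := supNorm_nonneg x
  rw [EuclideanSpace.norm_eq]
  apply Real.sqrt_le_iff.2 ⟨by positivity, ?_⟩
  calc ∑ i, ‖x i‖ ^ 2 ≤ ∑ _i : Fin (d + 1), supNorm x ^ 2 :=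
        Finset.sum_le_sum fun i _ => pow_le_pow_left₀ (norm_nonneg _) (abs_apply_le_supNorm x i) 2
    _ = (d + 1) * supNorm x ^ 2 := by simp
    _ ≤ ((d + 1) * supNorm x) ^ 2 := by
        have : (0 : ℝ) ≤ d := d.cast_nonneg
        nlinarith [mul_nonneg this (sq_nonneg (supNorm x)), mul_nonneg (mul_nonneg this this) (sq_nonneg (supNorm x))]

theorem supNorm_pos {x : Space d} (hx : x ≠ 0) : 0 < supNorm x := by
  have h := norm_le_supNorm x
  have h1 : 0 < ‖x‖ := norm_pos_iff.2 hx
  by_contra! h2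
  have : supNorm x = 0 := le_antisymm h2 (supNorm_nonneg x)
  rw [this] at h
  linarith

theorem norm_le_of_mem_cube {x : Space d} (hx : x ∈ cube d) : ‖x‖ ≤ d + 1 := by
  have h := norm_le_supNorm x
  rw [show supNorm x = 1 from hx] at h
  linarith

theorem one_le_norm_of_mem_cube {x : Space d} (hx : x ∈ cube d) : 1 ≤ ‖x‖ :=
  (show supNorm x = 1 from hx) ▸ supNorm_le_norm x

theorem ne_zero_of_mem_cube {x : Space d} (hx : x ∈ cube d) : x ≠ 0 :=
  norm_pos_iff.1 (one_pos.trans_le (one_le_norm_of_mem_cube hx))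

theorem radial_mem_cube {x : Space d} (hx : x ≠ 0) : radial x ∈ cube d := by
  have h := supNorm_pos hx
  change supNorm ((supNorm x)⁻¹ • x) = 1
  rw [supNorm_smul, abs_of_pos (inv_pos.2 h), inv_mul_cancel₀ h.ne']

theorem supNorm_smul_radial (x : Space d) : supNorm x • radial x = x := by
  by_cases hx : x = 0
  · simp [hx, radial]
  · simp [radial, smul_smul, mul_inv_cancel₀ (supNorm_pos hx).ne']

theorem radial_smul {a : ℝ} (ha : 0 < a) (x : Space d) : radial (a • x) = radial x := by
  rw [radial, radial, supNorm_smul, abs_of_pos ha, smul_smul, mul_inv, mul_comm a⁻¹, mul_assoc,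
    inv_mul_cancel₀ ha.ne', mul_one]

theorem radial_eq_self {x : Space d} (hx : x ∈ cube d) : radial x = x := by
  rw [radial, show supNorm x = 1 from hx, inv_one, one_smul]

/-- The difference of the projections, scaled by `supNorm x`, is x - y plus a multiple of `radial y`
whose coefficient is at most ‖x - y‖; points of the cube have norm at most d + 1. -/
theorem norm_radial_sub_radial_le {x y : Space d} (hx : x ≠ 0) (hy : y ≠ 0) :
    ‖radial x - radial y‖ ≤ (d + 2) / supNorm x * ‖x - y‖ := by
  have h := supNorm_pos hx
  have e : radial x - radial y
      = (supNorm x)⁻¹ • ((x - y) + (supNorm y - supNorm x) • radial y) := by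
    rw [sub_smul, supNorm_smul_radial, smul_add, smul_sub, smul_sub, smul_smul _ (supNorm x),
      inv_mul_cancel₀ h.ne', one_smul, radial]
    abel
  have h1 : ‖(x - y) + (supNorm y - supNorm x) • radial y‖ ≤ (d + 2) * ‖x - y‖ := by
    have a1 := norm_le_of_mem_cube (radial_mem_cube hy)
    have a2 : |supNorm y - supNorm x| ≤ ‖x - y‖ := by
      rw [abs_sub_comm]
      exact (abs_supNorm_sub_le x y).trans (supNorm_le_norm _)
    calc _ ≤ ‖x - y‖ + |supNorm y - supNorm x| * ‖radial y‖ := by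
          refine (norm_add_le _ _).trans_eq ?_
          rw [norm_smul, Real.norm_eq_abs]
      _ ≤ ‖x - y‖ + ‖x - y‖ * (d + 1) := by gcongr
      _ = _ := by ring
  rw [e, norm_smul, Real.norm_eq_abs, abs_of_pos (inv_pos.2 h), div_mul_eq_mul_div, inv_mul_eq_div]
  gcongr

/-! ### Bilipschitz constants -/

/-- A single Lipschitz bound in both directions makes the set of admissible constants nonempty;
without one, `sInf` would return the default 0. The inequalities are closed, so they pass to the
infimum. -/
theorem bilipConst_spec {f : Space d → Space d} {s : Set (Space d)} {L : ℝ}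
    (h : ∀ x ∈ s, ∀ y ∈ s, dist x y ≤ L * dist (f x) (f y) ∧ dist (f x) (f y) ≤ L * dist x y) :
    1 ≤ bilipConst f s ∧ ∀ x ∈ s, ∀ y ∈ s, dist x y ≤ bilipConst f s * dist (f x) (f y) ∧
      dist (f x) (f y) ≤ bilipConst f s * dist x y := by
  set S := {c | 1 ≤ c ∧ ∀ x ∈ s, ∀ y ∈ s,
    c⁻¹ * dist x y ≤ dist (f x) (f y) ∧ dist (f x) (f y) ≤ c * dist x y}
  have hne : S.Nonempty := by
    refine ⟨max L 1, le_max_right _ _, fun x hx y hy => ⟨?_, ?_⟩⟩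
    · rw [inv_mul_le_iff₀ (by positivity)]
      exact (h x hx y hy).1.trans (by gcongr; exact le_max_left _ _)
    · exact (h x hx y hy).2.trans (by gcongr; exact le_max_left _ _)
  have key : ∀ a b : ℝ, 0 ≤ b → (∀ c ∈ S, a ≤ c * b) → a ≤ sInf S * b := by
    intro a b hb hc
    rcases hb.eq_or_lt with rfl | hb
    · obtain ⟨c, hcS⟩ := hne
      simpa using hc c hcS
    · rw [← div_le_iff₀ hb]
      exact le_csInf hne fun c hcS => (div_le_iff₀ hb).2 (hc c hcS)
  refine ⟨le_csInf hne fun c hc => hc.1, fun x hx y hy =>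
    ⟨key _ _ dist_nonneg fun c hc => ?_, key _ _ dist_nonneg fun c hc => (hc.2 x hx y hy).2⟩⟩
  have := (hc.2 x hx y hy).1
  rwa [inv_mul_le_iff₀ (one_pos.trans_le hc.1)] at this

/-- On the thickened face x 0 ≥ 1/2, which bounds the projection; its inverse is `radial`, Lipschitz
where the sup norm is at least 1. -/
theorem cPi_spec (d : ℕ) : 1 ≤ cPi d ∧ ∀ x ∈ thickFace d, ∀ y ∈ thickFace d,
    dist x y ≤ cPi d * dist ((x 0)⁻¹ • x) ((y 0)⁻¹ • y) ∧
      dist ((x 0)⁻¹ • x) ((y 0)⁻¹ • y) ≤ cPi d * dist x y := by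
  apply bilipConst_spec (L := 4 * d + 6)
  intro x hx y hy
  have pos : ∀ z ∈ thickFace d, 1 / 2 ≤ z 0 := fun z hz => by linarith [(abs_le.1 hz.2).1]
  have x0 := pos x hx
  have y0 := pos y hy
  have hd : (0 : ℝ) ≤ d := d.cast_nonneg
  simp only [dist_eq_norm]
  constructor
  · have hu : ∀ z ∈ thickFace d, 1 ≤ supNorm ((z 0)⁻¹ • z) ∧ (z 0)⁻¹ • z ≠ 0 ∧
        radial ((z 0)⁻¹ • z) = z := by
      intro z hz
      have z0 := pos z hz
      have hz0 : z 0 ≠ 0 := by linarith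
      refine ⟨?_, smul_ne_zero (inv_ne_zero hz0) (ne_zero_of_mem_cube hz.1), ?_⟩
      · have := abs_apply_le_supNorm ((z 0)⁻¹ • z) 0
        simpa [hz0] using this
      · rw [radial_smul (by positivity), radial_eq_self hz.1]
    obtain ⟨a1, a2, a3⟩ := hu x hx
    obtain ⟨-, b2, b3⟩ := hu y hy
    have := norm_radial_sub_radial_le a2 b2
    rw [a3, b3] at this
    refine this.trans ?_
    gcongr
    rw [div_le_iff₀ (by linarith)]
    nlinarith
  · have e : (x 0)⁻¹ • x - (y 0)⁻¹ • y = (x 0)⁻¹ • (x - y) + ((x 0)⁻¹ - (y 0)⁻¹) • y := by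
      rw [smul_sub, sub_smul]; abel
    have hx2 : (x 0)⁻¹ ≤ 2 := by
      rw [inv_le_comm₀ (by linarith) (by norm_num)]; linarith
    have hy2 : (y 0)⁻¹ ≤ 2 := by
      rw [inv_le_comm₀ (by linarith) (by norm_num)]; linarith
    have hxp : 0 < (x 0)⁻¹ := inv_pos.2 (by linarith)
    have hyp : 0 < (y 0)⁻¹ := inv_pos.2 (by linarith)
    have hdiff : |(x 0)⁻¹ - (y 0)⁻¹| ≤ 4 * ‖x - y‖ := by
      have : (x 0)⁻¹ - (y 0)⁻¹ = (x 0)⁻¹ * (y 0)⁻¹ * -((x - y) 0) := by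
        have : x 0 ≠ 0 := by linarith
        have : y 0 ≠ 0 := by linarith
        simp only [PiLp.sub_apply]
        field_simp
        ring
      rw [this, abs_mul, abs_of_pos (by positivity), abs_neg]
      have h4 : (x 0)⁻¹ * (y 0)⁻¹ ≤ 4 := by nlinarith
      exact mul_le_mul h4 (abs_apply_le_norm _ 0) (abs_nonneg _) (by norm_num)
    rw [e]
    calc _ ≤ (x 0)⁻¹ * ‖x - y‖ + |(x 0)⁻¹ - (y 0)⁻¹| * ‖y‖ := by
          refine (norm_add_le _ _).trans_eq ?_
          rw [norm_smul, norm_smul, Real.norm_eq_abs, Real.norm_eq_abs, abs_of_pos hxp]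
      _ ≤ 2 * ‖x - y‖ + 4 * ‖x - y‖ * (d + 1) := by
          gcongr
          exact norm_le_of_mem_cube hy.1
      _ = _ := by ring

/-- Injective linear maps of Euclidean space are bounded below. -/
theorem exists_pos_mul_norm_le (A : Space d →L[ℝ] Space d) (hA : Function.Injective A) :
    ∃ μ : ℝ, 0 < μ ∧ ∀ x, μ * ‖x‖ ≤ ‖A x‖ := by
  obtain ⟨K, hK, h⟩ := (A : Space d →ₗ[ℝ] Space d).exists_antilipschitzWith
    (LinearMap.ker_eq_bot.2 hA)
  refine ⟨(K : ℝ)⁻¹, by positivity, fun x => ?_⟩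
  rw [inv_mul_le_iff₀ (by positivity)]
  simpa using h.le_mul_dist x 0

theorem exists_lipschitz_radial_comp (A : Space d →L[ℝ] Space d) (hA : Function.Injective A) :
    ∃ L : ℝ, ∀ x ∈ cube d, ∀ y ∈ cube d,
      dist (radial (A x)) (radial (A y)) ≤ L * dist x y := by
  obtain ⟨μ, hμ, h⟩ := exists_pos_mul_norm_le A hA
  have hne : ∀ x ∈ cube d, A x ≠ 0 := fun x hx h0 =>
    ne_zero_of_mem_cube hx (hA (by rw [h0, map_zero]))
  refine ⟨(d + 2) / (μ / (d + 1)) * ‖A‖, fun x hx y hy => ?_⟩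
  have hd : (0 : ℝ) ≤ d := d.cast_nonneg
  have hx1 : μ / (d + 1) ≤ supNorm (A x) := by
    rw [div_le_iff₀ (by positivity)]
    have h1 := one_le_norm_of_mem_cube hx
    have h2 := norm_le_supNorm (A x)
    nlinarith [h x]
  rw [dist_eq_norm, dist_eq_norm, mul_assoc]
  refine (norm_radial_sub_radial_le (hne x hx) (hne y hy)).trans ?_
  rw [← map_sub]
  gcongr
  exact A.le_opNorm _

/-- The point is that the infimum is over a nonempty set: the map induced by M is Lipschitz, and so
is its inverse, which is induced by M⁻¹. -/
theorem one_le_cMat (M : GL (Fin (d + 1)) ℚ) : 1 ≤ cMat M := by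
  let F : Matrix (Fin (d + 1)) (Fin (d + 1)) ℚ → Space d →L[ℝ] Space d :=
    fun N => Matrix.toEuclideanCLM (𝕜 := ℝ) (N.map (algebraMap ℚ ℝ))
  have hF : ∀ N N', N * N' = 1 → ∀ x, F N (F N' x) = x := by
    intro N N' h x
    have : F N * F N' = 1 := by
      rw [← map_mul, ← Matrix.map_mul, h, Matrix.map_one _ (map_zero _) (map_one _), map_one]
    exact congrArg (fun G : Space d →L[ℝ] Space d => G x) this
  have h1 := hF M.val M⁻¹.val (by simp)
  have h2 := hF M⁻¹.val M.val (by simp)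
  obtain ⟨L, hL⟩ := exists_lipschitz_radial_comp (F M.val) (Function.LeftInverse.injective h2)
  obtain ⟨L', hL'⟩ := exists_lipschitz_radial_comp (F M⁻¹.val) (Function.LeftInverse.injective h1)
  have hne : ∀ x ∈ cube d, F M.val x ≠ 0 := fun x hx h0 =>
    ne_zero_of_mem_cube hx (Function.LeftInverse.injective h2 (by rw [h0, map_zero]))
  have hinv : ∀ x ∈ cube d, radial (F M⁻¹.val (radial (F M.val x))) = x := by
    intro x hx
    rw [show radial (F M.val x) = (supNorm (F M.val x))⁻¹ • F M.val x from rfl, map_smul, h2,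
      radial_smul (inv_pos.2 (supNorm_pos (hne x hx))), radial_eq_self hx]
  refine (bilipConst_spec (L := max L L') fun x hx y hy => ⟨?_, ?_⟩).1
  · have := hL' _ (radial_mem_cube (hne x hx)) _ (radial_mem_cube (hne y hy))
    rw [hinv x hx, hinv y hy] at this
    exact this.trans (mul_le_mul_of_nonneg_right (le_max_right _ _) dist_nonneg)
  · exact (hL x hx y hy).trans (mul_le_mul_of_nonneg_right (le_max_left _ _) dist_nonneg)

/-! ### Charts of the cube -/

/-- The signed permutation `x ↦ σ (x ∘ (0 j))`. -/
theorem exists_signed_swap (j : Fin (d + 1)) {σ : ℝ} (hσ : |σ| = 1) :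
    ∃ T : Space d →ₗ[ℝ] Space d, (∀ x, ‖T x‖ = ‖x‖) ∧ (∀ x, supNorm (T x) = supNorm x) ∧
      ∀ x, T x 0 = σ * x j := by
  let P := LinearIsometryEquiv.piLpCongrLeft 2 ℝ ℝ (Equiv.swap 0 j)
  have hP : ∀ x : Space d, ∀ i, P x i = x (Equiv.swap 0 j i) := fun x i => by
    simp [P, LinearIsometryEquiv.piLpCongrLeft_apply, Equiv.piCongrLeft']
  refine ⟨σ • P.toLinearEquiv.toLinearMap, fun x => ?_, fun x => ?_, fun x => ?_⟩
  · change ‖σ • P x‖ = _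
    rw [norm_smul, Real.norm_eq_abs, hσ, one_mul, P.norm_map]
  · change supNorm (σ • P x) = _
    rw [supNorm_smul, hσ, one_mul]
    apply le_antisymm <;> refine (supNorm_le_iff (supNorm_nonneg _)).2 fun i => ?_
    · rw [hP]; exact abs_apply_le_supNorm _ _
    · have := abs_apply_le_supNorm (P x) (Equiv.swap 0 j i)
      rwa [hP, Equiv.swap_apply_self] at this
  · change σ * P x 0 = _
    rw [hP, Equiv.swap_apply_left]

/-- A signed coordinate swap carries any face to the face x 0 = 1 and preserves both norms, so one
constant serves all 2(d+1) charts. -/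
theorem cPi_chart (j : Fin (d + 1)) {σ : ℝ} (hσ : |σ| = 1) {x y : Space d} (hx : x ∈ cube d)
    (hxj : 1 / 2 ≤ σ * x j) (hy : y ∈ cube d) (hyj : 1 / 2 ≤ σ * y j) :
    ‖x - y‖ ≤ cPi d * ‖(σ * x j)⁻¹ • x - (σ * y j)⁻¹ • y‖ ∧
      ‖(σ * x j)⁻¹ • x - (σ * y j)⁻¹ • y‖ ≤ cPi d * ‖x - y‖ := by
  obtain ⟨T, h1, h2, h3⟩ := exists_signed_swap j hσ
  have mem : ∀ z ∈ cube d, 1 / 2 ≤ σ * z j → T z ∈ thickFace d := by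
    intro z hz hzj
    refine ⟨(h2 z).trans hz, ?_⟩
    have := (abs_le.1 (abs_apply_le_supNorm (T z) 0)).2
    rw [h2, show supNorm z = 1 from hz, h3] at this
    rw [h3, abs_le]
    constructor <;> linarith
  have := (cPi_spec d).2 _ (mem x hx hxj) _ (mem y hy hyj)
  simpa only [dist_eq_norm, h3, ← map_smul, ← map_sub, h1] using this

/-! ### Moving on a quadric -/

/-- A functional which is tangent to the quadric at `v` and constant on the trace of a totally
isotropic set in the chart `x j = const`. -/
theorem exists_tangent (hd : 2 ≤ d) (J : Space d →L[ℝ] Space d) (hJ : Function.Injective J)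
    (v : Space d) (j : Fin (d + 1)) {U : Set (Space d)}
    (hU : ∀ a ∈ U, ∀ b ∈ U, ⟪a, J b⟫ = 0) {a₀ : Space d} (ha₀ : a₀ ∈ U) (ha₀j : a₀ j ≠ 0) :
    ∃ τ : Space d, ‖τ‖ = 1 ∧ τ j = 0 ∧ ⟪τ, J v⟫ = 0 ∧ ∃ t : ℝ, ∀ a ∈ U, ⟪τ, a⟫ = t * a j := by
  set W := Submodule.span ℝ U with hW
  have hWiso : ∀ a ∈ W, ∀ b ∈ W, ⟪a, J b⟫ = 0 := by
    intro a ha b hb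
    induction ha using Submodule.span_induction with
    | mem a ha =>
      induction hb using Submodule.span_induction with
      | mem b hb => exact hU a ha b hb
      | zero => simp
      | add x y _ _ hx hy => rw [map_add, inner_add_right, hx, hy, add_zero]
      | smul c x _ hx => rw [map_smul, inner_smul_right, hx, mul_zero]
    | zero => simp
    | add x y _ _ hx hy => rw [inner_add_left, hx, hy, add_zero]
    | smul c x _ hx => rw [inner_smul_left, hx, mul_zero]
  -- `J` maps W injectively into its orthogonal complement.
  have hdim : 2 * Module.finrank ℝ W ≤ d + 1 := by
    have h1 : W.map (J : Space d →ₗ[ℝ] Space d) ≤ Wᗮ := by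
      rintro _ ⟨b, hb, rfl⟩
      exact (Submodule.mem_orthogonal _ _).2 fun a ha => hWiso a ha b hb
    have h2 := Submodule.finrank_mono h1
    rw [← (Submodule.equivMapOfInjective (J : Space d →ₗ[ℝ] Space d) hJ W).finrank_eq] at h2
    have h3 := W.finrank_add_finrank_orthogonal
    rw [finrank_euclideanSpace_fin] at h3
    omega
  let e : Space d := EuclideanSpace.single j 1
  have hej : ∀ x : Space d, ⟪x, e⟫ = x j := fun x => by
    simp [e, EuclideanSpace.inner_single_right]
  let n : Space d := J v - (J v j) • e
  -- Here d ≥ 2 enters: (d+1)/2 + 1 < d + 1 leaves a nonzero l orthogonal to W and to n. Removing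
  -- its j-th coordinate gives τ, and ⟪τ, J v⟫ = ⟪l, n⟫.
  have hS : Module.finrank ℝ (W ⊔ Submodule.span ℝ {n} : Submodule ℝ (Space d)) < d + 1 := by
    have h1 := Submodule.finrank_add_le_finrank_add_finrank W (Submodule.span ℝ {n})
    have h2 := finrank_span_le_card (R := ℝ) ({n} : Set (Space d))
    simp only [Set.toFinset_singleton, Finset.card_singleton] at h2
    omega
  obtain ⟨l, hl, hl0⟩ : ∃ l ∈ (W ⊔ Submodule.span ℝ {n})ᗮ, l ≠ 0 := by
    apply Submodule.exists_mem_ne_zero_of_ne_bot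
    intro h
    have h3 := (W ⊔ Submodule.span ℝ {n}).finrank_add_finrank_orthogonal
    rw [finrank_euclideanSpace_fin, h, finrank_bot] at h3
    omega
  have hlW : ∀ a ∈ U, ⟪l, a⟫ = 0 := fun a ha => by
    rw [real_inner_comm]
    exact (Submodule.mem_orthogonal _ _).1 hl a (Submodule.mem_sup_left (Submodule.subset_span ha))
  have hln : ⟪l, n⟫ = 0 := by
    rw [real_inner_comm]
    exact (Submodule.mem_orthogonal _ _).1 hl n
      (Submodule.mem_sup_right (Submodule.mem_span_singleton_self n))
  have hejj : e j = 1 := by simp [e]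
  let τ := l - l j • e
  -- Otherwise l is a multiple of e, and orthogonality to a₀ forces l = 0.
  have hτ0 : τ ≠ 0 := by
    intro h
    have hle : l = l j • e := sub_eq_zero.1 h
    have h1 := hlW a₀ ha₀
    rw [hle, inner_smul_left, real_inner_comm, hej] at h1
    have h2 : l j = 0 := by simpa [ha₀j] using h1
    exact hl0 (by rw [hle, h2, zero_smul])
  have hτpos : 0 < ‖τ‖ := norm_pos_iff.2 hτ0
  have hτa : ∀ x : Space d, ⟪τ, x⟫ = ⟪l, x⟫ - l j * x j := fun x => by
    rw [inner_sub_left, inner_smul_left, real_inner_comm x e, hej]; rfl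
  refine ⟨‖τ‖⁻¹ • τ, ?_, ?_, ?_, -(‖τ‖⁻¹ * l j), fun a ha => ?_⟩
  · rw [norm_smul, norm_inv, norm_norm, inv_mul_cancel₀ hτpos.ne']
  · simp [τ, hejj]
  · have h1 : ⟪l, J v⟫ = J v j * l j := by
      have := hln
      rw [inner_sub_right, inner_smul_right, hej] at this
      linarith
    rw [inner_smul_left, hτa, h1, mul_comm (l j), sub_self, mul_zero]
  · rw [inner_smul_left, hτa, hlW a ha]
    simp only [conj_trivial]
    ring

/-- Intermediate value theorem: at t = ±C s² the term 2tN outweighs the others, which total at most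
2q s². -/
theorem exists_small_root {A B D N C q s : ℝ} (hC : 0 ≤ C) (hq : 0 ≤ q) (hA : |A| ≤ q)
    (hB : |B| ≤ q) (hD : |D| ≤ q) (hN : 2 * q ≤ C * N) (hs1 : |s| ≤ 1)
    (hs2 : |s| * (2 * C + C ^ 2) ≤ 1) :
    ∃ t : ℝ, |t| ≤ C * s ^ 2 ∧ s ^ 2 * A + 2 * t * N + 2 * s * t * B + t ^ 2 * D = 0 := by
  have hCs : 0 ≤ C * s ^ 2 := by positivity
  have hqs : 0 ≤ q * s ^ 2 := by positivity
  have a4 : |s| * (|s| * C ^ 2) ≤ 1 * (|s| * C ^ 2) := by gcongr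
  have a5 : 2 * |s| * C + s ^ 2 * C ^ 2 ≤ 1 := by
    rw [← sq_abs s]
    linarith
  have a6 := mul_le_mul_of_nonneg_left a5 hqs
  have a7 := mul_le_mul_of_nonneg_right hN (sq_nonneg s)
  have hbound : ∀ t, |t| = C * s ^ 2 →
      |s ^ 2 * A + 2 * s * t * B + t ^ 2 * D| ≤ 2 * q * s ^ 2 := by
    intro t ht
    have a1 : |s ^ 2 * A| ≤ s ^ 2 * q := by
      rw [abs_mul, abs_of_nonneg (sq_nonneg s)]
      gcongr
    have a2 : |2 * s * t * B| ≤ 2 * |s| * (C * s ^ 2) * q := by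
      rw [abs_mul, abs_mul, abs_mul, ht, abs_two]
      gcongr
    have a3 : |t ^ 2 * D| ≤ (C * s ^ 2) ^ 2 * q := by
      rw [abs_mul, abs_pow, ht]
      gcongr
    have b1 := abs_add_le (s ^ 2 * A + 2 * s * t * B) (t ^ 2 * D)
    have b2 := abs_add_le (s ^ 2 * A) (2 * s * t * B)
    linarith
  let h : ℝ → ℝ := fun t => s ^ 2 * A + 2 * t * N + 2 * s * t * B + t ^ 2 * D
  have hcont : Continuous h := by fun_prop
  have hpos : 0 ≤ h (C * s ^ 2) := by
    have := (abs_le.1 (hbound (C * s ^ 2) (abs_of_nonneg hCs))).1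
    simp only [h]
    linarith
  have hneg : h (-(C * s ^ 2)) ≤ 0 := by
    have := (abs_le.1 (hbound (-(C * s ^ 2)) (by rw [abs_neg, abs_of_nonneg hCs]))).2
    simp only [h]
    linarith
  obtain ⟨t, ht, ht0⟩ := intermediate_value_Icc (neg_le_self hCs) hcont.continuousOn ⟨hneg, hpos⟩
  exact ⟨t, abs_le.2 ht, ht0⟩

/-- Small tangent moves can be corrected to stay on the quadric, with a quadratic error that is
orthogonal to the direction of the move. -/
theorem exists_move_on_quadric (J : Space d →L[ℝ] Space d) (hsymm : ∀ x y, ⟪x, J y⟫ = ⟪J x, y⟫)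
    (hJ : Function.Injective J) :
    ∃ C s₀ : ℝ, 0 < C ∧ 0 < s₀ ∧ ∀ v ∈ cube d, ⟪v, J v⟫ = 0 → ∀ j, |v j| = 1 →
      ∀ τ : Space d, ‖τ‖ = 1 → τ j = 0 → ⟪τ, J v⟫ = 0 → ∀ s : ℝ, |s| ≤ s₀ →
        ∃ y : Space d, y j = v j ∧ ⟪y, J y⟫ = 0 ∧ ‖y - v‖ ≤ |s| + C * s ^ 2 ∧
          ⟪τ, y⟫ = ⟪τ, v⟫ + s := by
  obtain ⟨μ, hμ, hμJ⟩ := exists_pos_mul_norm_le J hJ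
  have hd : (0 : ℝ) ≤ d := d.cast_nonneg
  set q := ‖J‖ + 1 with hq
  have hq0 : 0 < q := by positivity
  set b₀ := μ / (d + 2) with hb₀
  have hb₀0 : 0 < b₀ := by positivity
  set C := 2 * q / b₀ with hC
  have hC0 : 0 < C := by positivity
  have hqB : ∀ x y : Space d, |⟪x, J y⟫| ≤ q * ‖x‖ * ‖y‖ := fun x y =>
    calc _ ≤ ‖x‖ * ‖J y‖ := abs_real_inner_le_norm _ _
      _ ≤ ‖x‖ * (‖J‖ * ‖y‖) := by gcongr; exact J.le_opNorm y
      _ ≤ ‖x‖ * (q * ‖y‖) := by gcongr; linarith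
      _ = _ := by ring
  refine ⟨C, min 1 (1 / (2 * C + C ^ 2)), hC0, by positivity,
    fun v hv hv0 j hvj τ hτ hτj hτv s hs => ?_⟩
  have hs1 : |s| ≤ 1 := hs.trans (min_le_left _ _)
  have hs2 : |s| * (2 * C + C ^ 2) ≤ 1 := by
    have := hs.trans (min_le_right _ _)
    rwa [le_div_iff₀ (by positivity)] at this
  let e : Space d := EuclideanSpace.single j 1
  have hej : ∀ x : Space d, ⟪x, e⟫ = x j := fun x => by
    simp [e, EuclideanSpace.inner_single_right]
  have hejj : e j = 1 := by simp [e]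
  have hen : ‖e‖ = 1 := by simp [e]
  let n₀ : Space d := J v - (J v j) • e
  have hn₀j : n₀ j = 0 := by simp [n₀, hejj]
  have hn₀x : ∀ x : Space d, x j = 0 → ⟪x, J v⟫ = ⟪x, n₀⟫ := fun x hx => by
    rw [inner_sub_right, inner_smul_right, hej, hx, mul_zero, sub_zero]
  -- Since ⟪v, J v⟫ = 0, the j-th coordinate of `J v` is controlled by the rest, n₀. So n₀, the
  -- gradient within the chart, is bounded below uniformly in v.
  have hJvj : |J v j| ≤ ‖n₀‖ * (d + 1) := by
    have h1 : ⟪v, n₀⟫ = -(J v j * v j) := by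
      rw [inner_sub_right, hv0, inner_smul_right, hej, zero_sub]
    have h2 : |J v j| = |⟪v, n₀⟫| := by rw [h1, abs_neg, abs_mul, hvj, mul_one]
    rw [h2, mul_comm]
    refine (abs_real_inner_le_norm _ _).trans ?_
    gcongr
    exact norm_le_of_mem_cube hv
  have hn₀ : b₀ ≤ ‖n₀‖ := by
    have h1 : ‖J v‖ ≤ ‖n₀‖ + |J v j| := by
      have : J v = n₀ + (J v j) • e := by simp [n₀]
      rw [this]
      refine (norm_add_le _ _).trans ?_
      rw [norm_smul, hen, mul_one, ← this, Real.norm_eq_abs]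
    have h2 := hμJ v
    have h3 := one_le_norm_of_mem_cube hv
    rw [hb₀, div_le_iff₀ (by positivity)]
    nlinarith
  have hn₀0 : 0 < ‖n₀‖ := hb₀0.trans_le hn₀
  let n : Space d := ‖n₀‖⁻¹ • n₀
  have hn : ‖n‖ = 1 := by
    rw [norm_smul, norm_inv, norm_norm, inv_mul_cancel₀ hn₀0.ne']
  have hnj : n j = 0 := by simp [n, hn₀j]
  have hnv : ⟪n, J v⟫ = ‖n₀‖ := by
    rw [hn₀x n hnj, inner_smul_left, real_inner_self_eq_norm_sq]
    simp only [conj_trivial]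
    field_simp
  have hτn : ⟪τ, n⟫ = 0 := by
    rw [inner_smul_right, ← hn₀x τ hτj, hτv, mul_zero]
  have hsw : ∀ x y : Space d, ⟪x, J y⟫ = ⟪y, J x⟫ := fun x y => by
    rw [hsymm, real_inner_comm]
  -- The step s • τ changes the form only to second order, so a correction t of order s² along n
  -- suffices; n is orthogonal to τ and leaves that coordinate alone.
  let y : ℝ → Space d := fun t => v + s • τ + t • n
  let h : ℝ → ℝ := fun t => ⟪y t, J (y t)⟫
  have hval : ∀ t, h t = s ^ 2 * ⟪τ, J τ⟫ + 2 * t * ‖n₀‖ + 2 * s * t * ⟪τ, J n⟫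
      + t ^ 2 * ⟪n, J n⟫ := by
    intro t
    simp only [h, y, map_add, map_smul, inner_add_left, inner_add_right, inner_smul_left,
      inner_smul_right, conj_trivial, hv0, hτv, hnv, hsw v τ, hsw v n, hsw n τ]
    ring
  have e1 := hqB τ τ
  have e2 := hqB τ n
  have e3 := hqB n n
  simp only [hτ, hn, mul_one] at e1 e2 e3
  have hCb : C * b₀ = 2 * q := by rw [hC]; field_simp
  have hCn : 2 * q ≤ C * ‖n₀‖ := hCb ▸ mul_le_mul_of_nonneg_left hn₀ hC0.le
  obtain ⟨t, ht, ht0⟩ := exists_small_root hC0.le hq0.le e1 e2 e3 hCn hs1 hs2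
  refine ⟨y t, ?_, (hval t).trans ht0, ?_, ?_⟩
  · simp [y, hτj, hnj]
  · have : y t - v = s • τ + t • n := by simp only [y]; abel
    rw [this]
    refine (norm_add_le _ _).trans ?_
    rw [norm_smul, norm_smul, hτ, hn, mul_one, mul_one, Real.norm_eq_abs, Real.norm_eq_abs]
    gcongr
  · simp only [y, inner_add_right, inner_smul_right, hτn, real_inner_self_eq_norm_sq, hτ]
    ring

/-- Here k is the signed distance to the forbidden level. If it is at least R/4 in size, stay, or
step further away; otherwise step to both sides, where 13/16 - 1/4 ≥ 1/4. -/
theorem exists_two_steps (k : ℝ) {R : ℝ} (hR : 0 < R) :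
    ∃ s : Fin 2 → ℝ, (∀ i, |s i| ≤ 13 / 16 * R) ∧ 13 / 16 * R ≤ |s 0 - s 1| ∧
      ∀ i, R / 4 ≤ |k + s i| := by
  have h3 : 0 < 13 / 16 * R := by positivity
  simp only [Fin.forall_fin_two]
  rcases le_total (R / 4) |k| with h | h
  · rcases le_total 0 k with h0 | h0
    · refine ⟨![0, 13 / 16 * R], ?_⟩
      rw [abs_of_nonneg h0] at h
      simp only [Matrix.cons_val_zero, Matrix.cons_val_one, abs_zero, zero_sub, abs_neg,
        abs_of_pos h3, le_refl, h3.le, add_zero, abs_of_nonneg h0, true_and, h]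
      exact le_abs.2 (Or.inl (by linarith))
    · refine ⟨![0, -(13 / 16 * R)], ?_⟩
      rw [abs_of_nonpos h0] at h
      simp only [Matrix.cons_val_zero, Matrix.cons_val_one, abs_zero, zero_sub, abs_neg,
        abs_of_pos h3, le_refl, h3.le, add_zero, abs_of_nonpos h0, true_and, h]
      exact le_abs.2 (Or.inr (by linarith))
  · obtain ⟨h1, h2⟩ := abs_le.1 h
    refine ⟨![13 / 16 * R, -(13 / 16 * R)], ?_⟩
    simp only [Matrix.cons_val_zero, Matrix.cons_val_one, abs_neg, abs_of_pos h3, le_refl,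
      true_and]
    exact ⟨le_abs.2 (Or.inl (by linarith)), le_abs.2 (Or.inl (by linarith)),
      le_abs.2 (Or.inr (by linarith))⟩

/-- In a small ball of the light-cone, there are two far apart smaller balls, both of which keep
away from any given totally isotropic set. -/
theorem exists_two_moves (hd : 2 ≤ d) (J : Space d →L[ℝ] Space d)
    (hsymm : ∀ x y, ⟪x, J y⟫ = ⟪J x, y⟫) (hJ : Function.Injective J) {α : ℝ} (hα0 : 0 < α)
    (hα : α ≤ 1 / (8 * cPi d ^ 2)) :
    ∃ r : ℝ, 0 < r ∧ r ≤ 1 ∧ ∀ v ∈ cube d, ⟪v, J v⟫ = 0 → ∀ ρ : ℝ, 0 < ρ → ρ ≤ r →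
      ∀ U ⊆ cube d, (∀ a ∈ U, ∀ b ∈ U, ⟪a, J b⟫ = 0) → (∀ a ∈ U, ‖a - v‖ ≤ 2 * ρ) →
      ∃ w : Fin 2 → Space d, 6 * α * ρ < ‖w 0 - w 1‖ ∧ ∀ i, w i ∈ cube d ∧
        ⟪w i, J (w i)⟫ = 0 ∧ ‖w i - v‖ ≤ (1 - α) * ρ ∧
        ∀ z ∈ cube d, ‖z - w i‖ ≤ α * ρ → ∀ a ∈ U, α * ρ ≤ ‖a - z‖ := by
  obtain ⟨C, s₀, hC, hs₀, hmove⟩ := exists_move_on_quadric J hsymm hJ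
  have hc1 := (cPi_spec d).1
  set c := cPi d with hc
  have hc0 : 0 < c := by linarith
  have hαc : α * c * c ≤ 1 / 8 := by
    rw [le_div_iff₀ (by positivity)] at hα
    nlinarith
  have hα8 : α ≤ 1 / 8 := by
    have : α * 1 * 1 ≤ α * c * c := by gcongr
    linarith
  -- The bound 1/4 puts everything within 2ρ of v in one chart; 1/(16C) makes the quadratic
  -- correction at most R/16.
  refine ⟨min (1 / 4) (min s₀ (1 / (16 * C))), by positivity,
    (min_le_left _ _).trans (by norm_num), fun v hv hv0 ρ hρ hρr U hUc hU hUv => ?_⟩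
  obtain ⟨hρ1, hρ2, hρ3⟩ : ρ ≤ 1 / 4 ∧ ρ ≤ s₀ ∧ ρ ≤ 1 / (16 * C) := by
    simpa only [le_min_iff] using hρr
  obtain ⟨j, hj⟩ := exists_abs_apply_eq_supNorm v
  rw [show supNorm v = 1 from hv] at hj
  have hjj : v j * v j = 1 := by rw [← abs_mul_abs_self, hj, one_mul]
  have hthick : ∀ z : Space d, ‖z - v‖ ≤ 1 / 2 → 1 / 2 ≤ v j * z j := by
    intro z hz
    have h1 : |v j * (z j - v j)| ≤ 1 / 2 := by
      rw [abs_mul, hj, one_mul]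
      exact (abs_apply_le_norm (z - v) j).trans hz
    rw [mul_sub, hjj] at h1
    linarith [(abs_le.1 h1).1]
  let f : Space d → Space d := fun x => (v j * x j)⁻¹ • x
  have hchart : ∀ x ∈ cube d, ∀ y ∈ cube d, 1 / 2 ≤ v j * x j → 1 / 2 ≤ v j * y j →
      ‖x - y‖ ≤ c * ‖f x - f y‖ ∧ ‖f x - f y‖ ≤ c * ‖x - y‖ :=
    fun x hx y hy hxj hyj => cPi_chart j hj hx hxj hy hyj
  have hvthick := hthick v (by simp)
  have hfv : f v = v := by simp only [f]; rw [hjj, inv_one, one_smul]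
  have hv0j : v j ≠ 0 := fun h => by rw [h] at hjj; simp at hjj
  obtain ⟨τ, hτ, hτj, hτv, t, ht⟩ : ∃ τ : Space d, ‖τ‖ = 1 ∧ τ j = 0 ∧ ⟪τ, J v⟫ = 0 ∧
      ∃ t : ℝ, ∀ a ∈ U, ⟪τ, a⟫ = t * a j := by
    rcases U.eq_empty_or_nonempty with rfl | ⟨a₀, ha₀⟩
    -- With nothing to avoid, {v} is a totally isotropic set that still supplies a tangent
    -- direction.
    · obtain ⟨τ, h1, h2, h3, -⟩ := exists_tangent hd J hJ v j (U := {v})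
        (by simpa using hv0) rfl hv0j
      exact ⟨τ, h1, h2, h3, 0, by simp⟩
    · refine exists_tangent hd J hJ v j hU ha₀ fun h => ?_
      have := hthick a₀ ((hUv a₀ ha₀).trans (by linarith))
      rw [h] at this
      norm_num at this
  have hτf : ∀ a ∈ U, ⟪τ, f a⟫ = t * v j := by
    intro a ha
    have h1 := hthick a ((hUv a ha).trans (by linarith))
    have h2 : a j ≠ 0 := fun h => by rw [h] at h1; norm_num at h1
    simp only [f, inner_smul_right, ht a ha]
    field_simp
    linear_combination (-t) * hjj
  -- R is ρ seen in the chart, and a ball of radius αρ has chart radius at most R/8. In units of R: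
  -- step plus correction is 13/16 + 1/16 = 7/8 ≤ 1 - α; separation is 13/16 > 6/8; the distance
  -- kept from U is 1/4 - 1/8 = 1/8. This is where the 8 and c_π² in α come from.
  set R := ρ / c with hR
  have hR0 : 0 < R := by positivity
  have hRc : R * c = ρ := by rw [hR]; field_simp
  have hRρ : R ≤ ρ := by rw [← hRc]; nlinarith
  have hCR : C * R ≤ 1 / 16 := by
    have : C * R ≤ C * (1 / (16 * C)) := by gcongr; exact hRρ.trans hρ3
    refine this.trans_eq ?_
    field_simp
  have hαR : c * (α * ρ) ≤ R / 8 := by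
    rw [← hRc]
    nlinarith
  have hstep : ∀ s : ℝ, |s| ≤ 13 / 16 * R → ∃ w : Space d, w ∈ cube d ∧ ⟪w, J w⟫ = 0 ∧
      ‖w - v‖ ≤ (1 - α) * ρ ∧ 1 / 2 ≤ v j * w j ∧ ⟪τ, f w⟫ = ⟪τ, v⟫ + s := by
    intro s hs
    have hsR : |s| ≤ R := by linarith
    obtain ⟨y, hyj, hy0, hyv, hyτ⟩ := hmove v hv hv0 j hj τ hτ hτj hτv s
      (hsR.trans (hRρ.trans hρ2))
    have hyv' : ‖y - v‖ ≤ 7 / 8 * R := by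
      have : C * s ^ 2 ≤ 1 / 16 * R := by
        rw [← sq_abs]
        calc C * |s| ^ 2 ≤ C * R ^ 2 := by gcongr
          _ = C * R * R := by ring
          _ ≤ _ := by gcongr
      linarith
    have hyne : y ≠ 0 := fun h => hv0j (by rw [← hyj, h]; rfl)
    have hypos := supNorm_pos hyne
    have hysup : supNorm y ≤ 2 := by
      have h1 := supNorm_add_le v (y - v)
      have h2 := supNorm_le_norm (y - v)
      rw [add_sub_cancel, show supNorm v = 1 from hv] at h1
      linarith
    have hwj : v j * radial y j = (supNorm y)⁻¹ := by
      change v j * ((supNorm y)⁻¹ * y j) = _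
      rw [hyj]
      linear_combination (supNorm y)⁻¹ * hjj
    have hthk : 1 / 2 ≤ v j * radial y j := by
      rw [hwj, one_div]
      exact inv_anti₀ hypos hysup
    have hfw : f (radial y) = y := by
      change (v j * radial y j)⁻¹ • radial y = y
      rw [hwj, inv_inv, supNorm_smul_radial]
    refine ⟨radial y, radial_mem_cube hyne, ?_, ?_, hthk, by rw [hfw, hyτ]⟩
    · simp [radial, inner_smul_left, inner_smul_right, hy0]
    · have := (hchart _ (radial_mem_cube hyne) v hv hthk hvthick).1
      rw [hfw, hfv] at this
      calc _ ≤ c * (7 / 8 * R) := this.trans (by gcongr)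
        _ = 7 / 8 * ρ := by rw [← hRc]; ring
        _ ≤ _ := by gcongr; linarith
  obtain ⟨s, hs1, hs2, hs3⟩ := exists_two_steps (⟪τ, v⟫ - t * v j) hR0
  choose w hw1 hw2 hw3 hw4 hw5 using fun i => hstep (s i) (hs1 i)
  have hτle : ∀ x y : Space d, |⟪τ, x⟫ - ⟪τ, y⟫| ≤ ‖x - y‖ := fun x y => by
    rw [← inner_sub_right]
    refine (abs_real_inner_le_norm _ _).trans_eq ?_
    rw [hτ, one_mul]
  refine ⟨w, ?_, fun i => ⟨hw1 i, hw2 i, hw3 i, fun z hz hzw a ha => ?_⟩⟩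
  · have h1 := hτle (f (w 0)) (f (w 1))
    rw [hw5, hw5, add_sub_add_left_eq_sub] at h1
    have h2 := (hchart _ (hw1 0) _ (hw1 1) (hw4 0) (hw4 1)).2
    have h3 : 13 / 16 * R ≤ c * ‖w 0 - w 1‖ := by linarith
    have h4 : c * (6 * α * ρ) < c * ‖w 0 - w 1‖ := by linarith
    exact lt_of_mul_lt_mul_left h4 hc0.le
  · have hzv : ‖z - v‖ ≤ 1 / 2 := by
      have h1 := norm_sub_le_norm_sub_add_norm_sub z (w i) v
      have h2 := hw3 i
      nlinarith
    have hzt := hthick z hzv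
    have hat := hthick a ((hUv a ha).trans (by linarith))
    have h1 := hτle (f z) (f (w i))
    have h2 := (hchart z hz _ (hw1 i) hzt (hw4 i)).2
    have h3 : c * ‖z - w i‖ ≤ c * (α * ρ) := by gcongr
    have h4 := hτle (f a) (f z)
    have h5 := (hchart a (hUc ha) z hz hat hzt).2
    have h6 := hs3 i
    rw [hw5] at h1
    rw [hτf a ha] at h4
    have h7 : R / 8 ≤ c * ‖a - z‖ := by
      have h8 : ⟪τ, v⟫ - t * v j + s i = (⟪τ, f z⟫ - t * v j) - (⟪τ, f z⟫ - (⟪τ, v⟫ + s i)) := by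
        ring
      rw [h8] at h6
      have h9 := abs_sub (⟪τ, f z⟫ - t * v j) (⟪τ, f z⟫ - (⟪τ, v⟫ + s i))
      rw [abs_sub_comm] at h4
      linarith
    exact le_of_mul_le_mul_left (by linarith) hc0

/-! ### The symmetric operator of a rational quadratic form -/

/-- The symmetric operator of the real quadratic form attached to `Q`. -/
noncomputable def formOp (Q : QuadraticForm ℚ (Fin (d + 1) → ℚ)) : Space d →L[ℝ] Space d :=
  Matrix.toEuclideanCLM (𝕜 := ℝ) (Q.toMatrix'.map (algebraMap ℚ ℝ))

theorem inner_formOp (Q : QuadraticForm ℚ (Fin (d + 1) → ℚ)) (x y : Space d) :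
    ⟪x, formOp Q y⟫ = WithLp.ofLp x ⬝ᵥ
      (Q.toMatrix'.map (algebraMap ℚ ℝ)).mulVec (WithLp.ofLp y) := by
  rw [EuclideanSpace.inner_eq_star_dotProduct, dotProduct_comm]
  rfl

theorem realForm_eq_inner (Q : QuadraticForm ℚ (Fin (d + 1) → ℚ)) (x : Space d) :
    realForm Q (WithLp.ofLp x) = ⟪x, formOp Q x⟫ := by
  rw [inner_formOp]
  exact Matrix.toLinearMap₂'_apply' (Q.toMatrix'.map (algebraMap ℚ ℝ)) (WithLp.ofLp x)
    (WithLp.ofLp x)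

theorem mem_boundary_iff (Q : QuadraticForm ℚ (Fin (d + 1) → ℚ)) (x : Space d) :
    x ∈ boundary Q ↔ ⟪x, formOp Q x⟫ = 0 ∧ x ∈ cube d := by
  rw [← realForm_eq_inner]
  rfl

theorem inner_formOp_comm (Q : QuadraticForm ℚ (Fin (d + 1) → ℚ)) (x y : Space d) :
    ⟪x, formOp Q y⟫ = ⟪formOp Q x, y⟫ := by
  rw [real_inner_comm y, inner_formOp, inner_formOp, Matrix.dotProduct_mulVec, dotProduct_comm,
    ← Matrix.mulVec_transpose, ← Matrix.transpose_map, Q.isSymm_toMatrix'.eq]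

theorem formOp_injective {Q : QuadraticForm ℚ (Fin (d + 1) → ℚ)}
    (hQ : (QuadraticMap.associated (R := ℚ) Q).Nondegenerate) :
    Function.Injective (formOp Q) := by
  have hdet : Q.toMatrix'.det ≠ 0 :=
    Matrix.nondegenerate_iff_det_ne_zero.1 (LinearMap.nondegenerate_toMatrix₂'_iff.2 hQ)
  have hdet' : (Q.toMatrix'.map (algebraMap ℚ ℝ)).det ≠ 0 := by
    have := (algebraMap ℚ ℝ).map_det Q.toMatrix'
    rw [RingHom.mapMatrix_apply] at this
    rw [← this]
    simpa using hdet
  intro x y hxy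
  have h := congrArg WithLp.ofLp hxy
  exact WithLp.ofLp_injective 2
    (Matrix.mulVec_injective_of_isUnit ((Matrix.isUnit_iff_isUnit_det _).2 hdet'.isUnit) h)

theorem inner_formOp_intVec (Q : QuadraticForm ℚ (Fin (d + 1) → ℚ)) (x y : Fin (d + 1) → ℤ) :
    ⟪intVec x, formOp Q (intVec y)⟫ =
      ((QuadraticMap.associated (R := ℚ) Q (fun i => (x i : ℚ)) (fun i => (y i : ℚ)) : ℚ) : ℝ) := by
  have h : QuadraticMap.associated (R := ℚ) Q (fun i => (x i : ℚ)) (fun i => (y i : ℚ)) =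
      (fun i => (x i : ℚ)) ⬝ᵥ Q.toMatrix'.mulVec fun i => (y i : ℚ) := by
    rw [← Matrix.toLinearMap₂'_apply', QuadraticForm.toMatrix', Matrix.toLinearMap₂'_toMatrix']
  rw [h, inner_formOp]
  simp [dotProduct, Matrix.mulVec, intVec]

theorem inner_formOp_of_mem_intPoints {Q : QuadraticForm ℚ (Fin (d + 1) → ℚ)} {m : ℚ}
    {x : Fin (d + 1) → ℤ} (hx : x ∈ intPoints Q m) :
    ⟪intVec x, formOp Q (intVec x)⟫ = m := by
  rw [inner_formOp_intVec, QuadraticMap.associated_eq_self_apply, show Q _ = m from hx]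

/-- The values of the bilinear form at integer vectors have a common denominator. -/
theorem exists_common_denominator (Q : QuadraticForm ℚ (Fin (d + 1) → ℚ)) :
    ∃ N : ℝ, 0 < N ∧ ∀ x y : Fin (d + 1) → ℤ,
      ∃ k : ℤ, ⟪intVec x, formOp Q (intVec y)⟫ * N = k := by
  obtain ⟨⟨N, hN⟩, h⟩ := IsLocalization.exist_integer_multiples_of_finite (nonZeroDivisors ℤ)
    fun p : Fin (d + 1) × Fin (d + 1) => Q.toMatrix' p.1 p.2
  choose A hA using h
  have hN0 : N ≠ 0 := nonZeroDivisors.ne_zero hN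
  have hA' : ∀ i j, (Q.toMatrix' i j : ℝ) * N = A (i, j) := by
    intro i j
    have := hA (i, j)
    simp only [zsmul_eq_mul, eq_intCast] at this
    rw [mul_comm]
    exact_mod_cast this.symm
  refine ⟨|(N : ℝ)|, by positivity, fun x y => ?_⟩
  have key : ⟪intVec x, formOp Q (intVec y)⟫ * N = ((∑ i, x i * ∑ j, A (i, j) * y j : ℤ) : ℝ) := by
    rw [inner_formOp]
    push_cast
    simp only [dotProduct, Matrix.mulVec, intVec, Matrix.map_apply, Finset.mul_sum,
      Finset.sum_mul, ← hA', eq_ratCast]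
    exact Finset.sum_congr rfl fun i _ => Finset.sum_congr rfl fun j _ => by ring
  rcases abs_choice (N : ℝ) with h | h
  · exact ⟨_, by rw [h, key]⟩
  · exact ⟨-_, by rw [h, mul_neg, key, Int.cast_neg]⟩

/-- The columns of M form an orthogonal basis for the associated bilinear form over ℚ. -/
theorem exists_diagonalizes (Q : QuadraticForm ℚ (Fin (d + 1) → ℚ)) :
    ∃ M : GL (Fin (d + 1)) ℚ, Diagonalizes M Q := by
  obtain ⟨v, hv⟩ := LinearMap.BilinForm.exists_orthogonal_basis
    (QuadraticForm.associated_isSymm ℚ Q)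
  let b : Module.Basis (Fin (d + 1)) ℚ (Fin (d + 1) → ℚ) :=
    v.reindex (finCongr (Module.finrank_fin_fun ℚ))
  have hb : ∀ i j, i ≠ j → QuadraticMap.associated (R := ℚ) Q (b i) (b j) = 0 := by
    intro i j hij
    simp only [b, Module.Basis.reindex_apply]
    exact hv fun h => hij ((finCongr _).symm.injective h)
  let M := (Pi.basisFun ℚ (Fin (d + 1))).toMatrix b
  have hM : ∀ j, M.mulVec (Pi.single j 1) = b j := by
    intro j
    ext i
    simp [M, Module.Basis.toMatrix_apply]
  have : Invertible M := (Pi.basisFun ℚ (Fin (d + 1))).invertibleToMatrix b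
  refine ⟨unitOfInvertible M, fun i j hij => ?_⟩
  change QuadraticForm.toMatrix' (Q.comp (Matrix.toLin' M)) i j = 0
  rw [QuadraticForm.toMatrix', LinearMap.toMatrix₂'_apply, QuadraticMap.associated_comp]
  simp only [LinearMap.compl₁₂_apply, Matrix.toLin'_apply, hM]
  exact hb i j hij

/-! ### Integer vectors near a point of the light-cone -/

theorem eq_zero_of_abs_mul_lt_one {x N : ℝ} (hN : 0 < N) (hx : ∃ k : ℤ, x * N = k)
    (h : |x| * N < 1) : x = 0 := by
  obtain ⟨k, hk⟩ := hx
  rw [← abs_of_pos hN, ← abs_mul, hk] at h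
  have : k = 0 := Int.abs_lt_one_iff.1 (by exact_mod_cast h)
  rw [this, Int.cast_zero] at hk
  exact (mul_eq_zero.1 hk).resolve_right hN.ne'

theorem intVec_sub (x y : Fin (d + 1) → ℤ) : intVec (x - y) = intVec x - intVec y := by
  ext i
  simp [intVec]

theorem intVec_ne_zero {x : Fin (d + 1) → ℤ} (hx : x ≠ 0) : intVec x ≠ 0 := by
  intro h
  apply hx
  ext i
  have := congrArg (fun z : Space d => z i) h
  simpa [intVec] using this

theorem one_le_supNorm_intVec {x : Fin (d + 1) → ℤ} (hx : x ≠ 0) : 1 ≤ supNorm (intVec x) := by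
  obtain ⟨i, hi⟩ := Function.ne_iff.1 hx
  refine le_trans ?_ (abs_apply_le_supNorm _ i)
  have : (1 : ℤ) ≤ |x i| := Int.one_le_abs hi
  change (1 : ℝ) ≤ |(x i : ℝ)|
  exact_mod_cast this

theorem finite_intVec_le (T : ℝ) : {x : Fin (d + 1) → ℤ | supNorm (intVec x) ≤ T}.Finite := by
  refine (Set.finite_Icc (fun _ => -⌊T⌋) (fun _ => ⌊T⌋)).subset fun x hx => ?_
  have h : ∀ i, |x i| ≤ ⌊T⌋ := fun i => by
    rw [Int.le_floor]
    push_cast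
    exact (abs_apply_le_supNorm (intVec x) i).trans hx
  exact ⟨fun i => (abs_le.1 (h i)).1, fun i => (abs_le.1 (h i)).2⟩

theorem norm_sub_supNorm_smul {x v : Space d} :
    ‖x - supNorm x • v‖ = supNorm x * ‖radial x - v‖ := by
  have : x - supNorm x • v = supNorm x • (radial x - v) := by rw [smul_sub, supNorm_smul_radial]
  rw [this, norm_smul, Real.norm_eq_abs, abs_of_nonneg (supNorm_nonneg x)]

theorem abs_inner_map_self_le (J : Space d →L[ℝ] Space d) {x : Space d} {r : ℝ} (hx : ‖x‖ ≤ r) :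
    |⟪x, J x⟫| ≤ ‖J‖ * r ^ 2 :=
  calc _ ≤ ‖x‖ * ‖J x‖ := abs_real_inner_le_norm _ _
    _ ≤ ‖x‖ * (‖J‖ * ‖x‖) := by gcongr; exact J.le_opNorm x
    _ = ‖J‖ * ‖x‖ ^ 2 := by ring
    _ ≤ _ := by gcongr

/-- Isotropic integer vectors of bounded height close to a given point are orthogonal. -/
theorem exists_isotropic_orthogonal (Q : QuadraticForm ℚ (Fin (d + 1) → ℚ)) :
    ∃ ε : ℝ, 0 < ε ∧ ∀ (v : Space d) (ρ : ℝ), 0 < ρ → ∀ x y : Fin (d + 1) → ℤ,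
      ⟪intVec x, formOp Q (intVec x)⟫ = 0 → ⟪intVec y, formOp Q (intVec y)⟫ = 0 →
      supNorm (intVec x) ≤ ε / ρ → supNorm (intVec y) ≤ ε / ρ →
      ‖radial (intVec x) - v‖ ≤ 2 * ρ → ‖radial (intVec y) - v‖ ≤ 2 * ρ →
      ⟪radial (intVec x), formOp Q (radial (intVec y))⟫ = 0 := by
  obtain ⟨N, hN, hint⟩ := exists_common_denominator Q
  set J := formOp Q
  set ε := min 1 (1 / (16 * (‖J‖ + 1) * N)) with hε
  have hε0 : 0 < ε := by positivity
  have hεN : 16 * (‖J‖ + 1) * N * ε ≤ 1 := by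
    have := min_le_right 1 (1 / (16 * (‖J‖ + 1) * N))
    rwa [← hε, le_div_iff₀ (by positivity), mul_comm] at this
  refine ⟨ε, hε0, fun v ρ hρ x y hx hy hxρ hyρ hxv hyv => ?_⟩
  set a := radial (intVec x) with ha
  set b := radial (intVec y) with hb
  have haa : ⟪a, J a⟫ = 0 := by simp [ha, radial, inner_smul_left, inner_smul_right, hx]
  have hbb : ⟪b, J b⟫ = 0 := by simp [hb, radial, inner_smul_left, inner_smul_right, hy]
  have hba : ⟪b, J a⟫ = ⟪a, J b⟫ := by rw [inner_formOp_comm, real_inner_comm]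
  have hab : ‖a - b‖ ≤ 4 * ρ := by
    have := norm_sub_le_norm_sub_add_norm_sub a v b
    rw [norm_sub_rev v b] at this
    linarith
  have h1 := abs_inner_map_self_le J hab
  -- Isotropy leaves only the cross term, so ⟪a, J b⟫ is of order ρ², while the product of the
  -- heights is at most (ε/ρ)².
  have h2 : ⟪a - b, J (a - b)⟫ = -2 * ⟪a, J b⟫ := by
    rw [map_sub, inner_sub_left, inner_sub_right, inner_sub_right, haa, hbb, hba]
    ring
  rw [h2, abs_mul, abs_neg, abs_two] at h1
  have h3 : ⟪intVec x, J (intVec y)⟫ = supNorm (intVec x) * supNorm (intVec y) * ⟪a, J b⟫ := by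
    conv_lhs => rw [← supNorm_smul_radial (intVec x), ← supNorm_smul_radial (intVec y)]
    rw [map_smul, inner_smul_left, inner_smul_right, conj_trivial, mul_assoc]
  have h4 : |⟪intVec x, J (intVec y)⟫| * N < 1 := by
    have n1 := supNorm_nonneg (intVec x)
    have n2 := supNorm_nonneg (intVec y)
    rw [h3, abs_mul, abs_mul, abs_of_nonneg n1, abs_of_nonneg n2]
    calc _ ≤ ε / ρ * (ε / ρ) * (8 * ‖J‖ * ρ ^ 2) * N := by
          gcongr
          linarith
      _ = 8 * ‖J‖ * N * ε * ε := by field_simp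
      _ ≤ 8 * ‖J‖ * N * ε * 1 := by gcongr; exact min_le_left _ _
      _ < 16 * (‖J‖ + 1) * N * ε := by
          have : 0 < N * ε := by positivity
          have : 0 ≤ ‖J‖ * (N * ε) := by positivity
          nlinarith
      _ ≤ 1 := hεN
  have h5 := eq_zero_of_abs_mul_lt_one hN (hint x y) h4
  have h6 : a = (supNorm (intVec x))⁻¹ • intVec x := rfl
  have h7 : b = (supNorm (intVec y))⁻¹ • intVec y := rfl
  rw [h6, h7, map_smul, inner_smul_left, inner_smul_right, h5, mul_zero, mul_zero]

/-- Arithmetic for `exists_separation`, with l the ratio of heights and b the bilinear value minus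
m; the δ and e terms each contribute at most 1/2 to 2|b|N. -/
theorem abs_mul_lt_one_of_near {A m N δ e l b : ℝ} (hA : 0 ≤ A) (hN : 0 < N) (he0 : 0 < e)
    (he1 : e ≤ 1) (hδ0 : 0 < δ) (hδ1 : δ ≤ 1) (hl1 : 1 ≤ l) (hl2 : l ≤ 1 + δ)
    (hδN : 2 * (|m| + 1) * N * δ ≤ 1) (heN : 72 * (A + 1) * N * e ≤ 1)
    (h : |m * (l - 1) ^ 2 - 2 * l * b| ≤ A * (6 * e) ^ 2) : |b| * N < 1 := by
  have h3 : 2 * l * |b| ≤ |m| * δ ^ 2 + A * (6 * e) ^ 2 := by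
    have h4 : |2 * l * b| = 2 * l * |b| := by
      rw [abs_mul, abs_of_pos (by linarith)]
    have h5 : |m * (l - 1) ^ 2| ≤ |m| * δ ^ 2 := by
      have h0 : 0 ≤ l - 1 := by linarith
      have h1 : l - 1 ≤ δ := by linarith
      rw [abs_mul, abs_of_nonneg (sq_nonneg (l - 1))]
      gcongr
    have h6 := abs_sub (m * (l - 1) ^ 2) (m * (l - 1) ^ 2 - 2 * l * b)
    rw [sub_sub_cancel, h4] at h6
    linarith
  have h7 : 2 * |b| ≤ 2 * l * |b| := by nlinarith [abs_nonneg b]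
  have h8 : |m| * δ * δ * N ≤ (|m| + 1) * δ * 1 * N := by
    gcongr
    linarith
  have h9 : A * e * e * N ≤ (A + 1) * e * 1 * N := by
    gcongr
    linarith
  have h10 : 2 * |b| * N ≤ (|m| * δ ^ 2 + A * (6 * e) ^ 2) * N :=
    mul_le_mul_of_nonneg_right (h7.trans h3) hN.le
  linarith

/-- Near a point that is badly approximable by isotropic integer vectors, the integer points of
the variety `Q = m` of given height have separated heights. -/
theorem exists_separation (Q : QuadraticForm ℚ (Fin (d + 1) → ℚ)) (m : ℚ) {ε c K : ℝ}
    (hε : 0 < ε) (hc : 0 < c) (hK : 1 ≤ K) :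
    ∃ δ e : ℝ, 0 < δ ∧ 0 < e ∧ ∀ v ∈ cube d, ∀ ρ ρ' : ℝ, 0 < ρ → ρ ≤ 1 → 0 < ρ' → ρ ≤ K * ρ' →
      (∀ u : Fin (d + 1) → ℤ, u ≠ 0 → ⟪intVec u, formOp Q (intVec u)⟫ = 0 →
        supNorm (intVec u) ≤ ε / ρ → c ≤ supNorm (intVec u) * ‖radial (intVec u) - v‖) →
      ∀ x ∈ intPoints Q m, x ≠ 0 → ∀ y ∈ intPoints Q m, y ≠ 0 →
        ‖radial (intVec x) - v‖ ≤ 2 * ρ' → ‖radial (intVec y) - v‖ ≤ 2 * ρ' →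
        supNorm (intVec x) ≤ e / ρ' → supNorm (intVec y) ≤ supNorm (intVec x) →
        supNorm (intVec x) ≤ (1 + δ) * supNorm (intVec y) → x = y := by
  obtain ⟨N, hN, hint⟩ := exists_common_denominator Q
  set J := formOp Q
  set δ := min 1 (1 / (2 * (|(m : ℝ)| + 1) * N)) with hδ
  have hδ0 : 0 < δ := by positivity
  have hδ1 : δ ≤ 1 := min_le_left _ _
  have hδN : 2 * (|(m : ℝ)| + 1) * N * δ ≤ 1 := by
    have := min_le_right 1 (1 / (2 * (|(m : ℝ)| + 1) * N))
    rwa [← hδ, le_div_iff₀ (by positivity), mul_comm] at this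
  obtain ⟨e, he0, he1, heN, heε, hec⟩ : ∃ e : ℝ, 0 < e ∧ e ≤ 1 ∧
      72 * (‖J‖ + 1) * N * e ≤ 1 ∧ (K + 4) * e ≤ ε ∧ 8 * (d + 2) * e ≤ c := by
    refine ⟨min (min 1 (1 / (72 * (‖J‖ + 1) * N))) (min (ε / (K + 4)) (c / (8 * (d + 2)))),
      by positivity, (min_le_left _ _).trans (min_le_left _ _), ?_, ?_, ?_⟩
    · rw [mul_comm, ← le_div_iff₀ (by positivity)]
      exact (min_le_left _ _).trans (min_le_right _ _)
    · rw [mul_comm, ← le_div_iff₀ (by positivity)]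
      exact (min_le_right _ _).trans (min_le_left _ _)
    · rw [mul_comm, ← le_div_iff₀ (by positivity)]
      exact (min_le_right _ _).trans (min_le_right _ _)
  refine ⟨δ, e, hδ0, he0, fun v hv ρ ρ' hρ hρ1 hρ' hρρ' havoid x hx hx0 y hy hy0 hxv hyv hxe hyx
    hxy => ?_⟩
  have hX1 := one_le_supNorm_intVec hx0
  have hY1 := one_le_supNorm_intVec hy0
  have hxx := inner_formOp_of_mem_intPoints hx
  have hyy := inner_formOp_of_mem_intPoints hy
  have hsw : ⟪intVec y, J (intVec x)⟫ = ⟪intVec x, J (intVec y)⟫ := by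
    rw [inner_formOp_comm, real_inner_comm]
  set X := supNorm (intVec x) with hX
  set Y := supNorm (intVec y) with hY
  set wx := intVec x - X • v with hwx
  set wy := intVec y - Y • v with hwy
  have hwx2 : ‖wx‖ ≤ 2 * e := by
    rw [hwx, norm_sub_supNorm_smul]
    calc _ ≤ e / ρ' * (2 * ρ') := by gcongr
      _ = _ := by field_simp
  have hwy2 : ‖wy‖ ≤ 2 * e := by
    rw [hwy, norm_sub_supNorm_smul]
    calc _ ≤ e / ρ' * (2 * ρ') := by gcongr; exact hyx.trans hxe
      _ = _ := by field_simp
  set l := X / Y with hl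
  have hY0 : 0 < Y := by linarith
  have hlY : l * Y = X := by rw [hl]; field_simp
  have hl1 : 1 ≤ l := by rw [hl, one_le_div hY0]; exact hyx
  have hl2 : l ≤ 1 + δ := by rw [hl, div_le_iff₀ hY0]; exact hxy
  have hz : ‖intVec x - l • intVec y‖ ≤ 6 * e := by
    have e1 : intVec x - l • intVec y = wx - l • wy := by
      rw [hwx, hwy, smul_sub, smul_smul, hlY]; abel
    rw [e1]
    refine (norm_sub_le _ _).trans ?_
    rw [norm_smul, Real.norm_eq_abs, abs_of_pos (by linarith)]
    nlinarith [norm_nonneg wy]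
  -- After rescaling y to the height of x, the form at x - l y is small, and so is m(l-1)². Their
  -- difference is 2l times this quantity, which lies in (1/N)ℤ and so vanishes.
  have hB : ⟪intVec x, J (intVec y)⟫ - m = 0 := by
    refine eq_zero_of_abs_mul_lt_one hN ?_ ?_
    · obtain ⟨k, hk⟩ := hint x y
      obtain ⟨k', hk'⟩ := hint x x
      rw [hxx] at hk'
      exact ⟨k - k', by push_cast; rw [sub_mul, hk, hk']⟩
    · have h1 := abs_inner_map_self_le J hz
      have h2 : ⟪intVec x - l • intVec y, J (intVec x - l • intVec y)⟫ =
          m * (l - 1) ^ 2 - 2 * l * (⟪intVec x, J (intVec y)⟫ - m) := by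
        rw [map_sub, map_smul, inner_sub_left, inner_sub_right, inner_sub_right, inner_smul_left,
          inner_smul_right, inner_smul_left, inner_smul_right, hxx, hyy, hsw, conj_trivial]
        ring
      rw [h2] at h1
      exact abs_mul_lt_one_of_near (norm_nonneg J) hN he0 he1 hδ0 hδ1 hl1 hl2 hδN heN h1
  by_contra hne
  have hu0 : x - y ≠ 0 := sub_ne_zero.2 hne
  have hu : intVec (x - y) = (X - Y) • v + (wx - wy) := by
    rw [intVec_sub, hwx, hwy, sub_smul]; abel
  have huiso : ⟪intVec (x - y), J (intVec (x - y))⟫ = 0 := by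
    rw [intVec_sub, map_sub, inner_sub_left, inner_sub_right, inner_sub_right, hxx, hyy, hsw]
    linarith
  have hw4 : ‖wx - wy‖ ≤ 4 * e := (norm_sub_le _ _).trans (by linarith)
  have hnear : |supNorm (intVec (x - y)) - (X - Y)| ≤ 4 * e := by
    have h1 := abs_supNorm_sub_le (intVec (x - y)) ((X - Y) • v)
    rw [supNorm_smul, show supNorm v = 1 from hv, mul_one, abs_of_nonneg (sub_nonneg.2 hyx), hu,
      add_sub_cancel_left, ← hu] at h1
    exact h1.trans ((supNorm_le_norm _).trans hw4)
  have hsmall : supNorm (intVec (x - y)) ≤ ε / ρ := by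
    rw [le_div_iff₀ hρ]
    have h1 : X * ρ ≤ e * K := by
      rw [le_div_iff₀ hρ'] at hxe
      calc X * ρ ≤ X * (K * ρ') := by gcongr
        _ = X * ρ' * K := by ring
        _ ≤ _ := by gcongr
    have h2 : supNorm (intVec (x - y)) ≤ X + 4 * e := by
      have := (abs_le.1 hnear).2
      nlinarith
    calc _ ≤ (X + 4 * e) * ρ := by gcongr
      _ = X * ρ + 4 * e * ρ := by ring
      _ ≤ e * K + 4 * e * 1 := by gcongr
      _ ≤ ε := by linarith
  -- The nonzero isotropic vector x - y is low enough for avoidance to apply, yet its height times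
  -- its distance to v is at most 4(d+2)e < c.
  have h1 := havoid _ hu0 huiso hsmall
  rw [← norm_sub_supNorm_smul] at h1
  have h2 : intVec (x - y) - supNorm (intVec (x - y)) • v =
      (wx - wy) - (supNorm (intVec (x - y)) - (X - Y)) • v := by
    generalize supNorm (intVec (x - y)) = t
    rw [hu]
    module
  have h3 : ‖intVec (x - y) - supNorm (intVec (x - y)) • v‖ ≤ 4 * e + 4 * e * (d + 1) := by
    rw [h2]
    refine (norm_sub_le _ _).trans ?_
    rw [norm_smul, Real.norm_eq_abs]
    gcongr
    exact norm_le_of_mem_cube hv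
  nlinarith

/-- A finite set with separated heights in a bounded multiplicative window is small. -/
theorem card_le_of_separated {ι : Type*} {h : ι → ℝ} {a δ : ℝ} (hδ : 0 < δ) (M : ℕ)
    (S : Finset ι) (hS : ∀ x ∈ S, a < h x ∧ h x ≤ a * (1 + δ) ^ M)
    (hsep : ∀ x ∈ S, ∀ y ∈ S, h y ≤ h x → h x ≤ (1 + δ) * h y → x = y) : S.card ≤ M := by
  classical
  induction M generalizing S with
  | zero =>
    have : S = ∅ := Finset.eq_empty_of_forall_notMem fun x hx => by
      have := hS x hx
      rw [pow_zero, mul_one] at this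
      exact absurd this.2 (not_le.2 this.1)
    simp [this]
  | succ M ih =>
    have h1 := ih (S.filter fun x => h x ≤ a * (1 + δ) ^ M)
      (fun x hx => ⟨(hS x (Finset.mem_filter.1 hx).1).1, (Finset.mem_filter.1 hx).2⟩)
      (fun x hx y hy => hsep x (Finset.mem_filter.1 hx).1 y (Finset.mem_filter.1 hy).1)
    -- Two heights in the top window have ratio at most 1 + δ.
    have h2 : (S.filter fun x => ¬ h x ≤ a * (1 + δ) ^ M).card ≤ 1 := by
      have key : ∀ x ∈ S, ∀ y ∈ S, ¬ h y ≤ a * (1 + δ) ^ M → h x ≤ (1 + δ) * h y := by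
        intro x hx y _ hy
        refine (hS x hx).2.trans ?_
        rw [pow_succ', mul_left_comm]
        exact mul_le_mul_of_nonneg_left (not_le.1 hy).le (by linarith)
      refine Finset.card_le_one.2 fun x hx y hy => ?_
      obtain ⟨hx, hx'⟩ := Finset.mem_filter.1 hx
      obtain ⟨hy, hy'⟩ := Finset.mem_filter.1 hy
      rcases le_total (h y) (h x) with hle | hle
      · exact hsep x hx y hy hle (key x hx y hy hy')
      · exact (hsep y hy x hx hle (key y hy x hx hx')).symm
    rw [← Finset.card_filter_add_card_filter_not (s := S) fun x => h x ≤ a * (1 + δ) ^ M]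
    omega

/-! ### The game -/

open Classical in
/-- In a small ball, Player A has a move that keeps away from the isotropic integer vectors of
small height, and halves the total weight of the remaining integer vectors. -/
theorem exists_avoiding_move (hd : 2 ≤ d) {Q : QuadraticForm ℚ (Fin (d + 1) → ℚ)}
    (hQ : (QuadraticMap.associated (R := ℚ) Q).Nondegenerate) {α : ℝ} (hα0 : 0 < α)
    (hα : α ≤ 1 / (8 * cPi d ^ 2)) :
    ∃ r ε : ℝ, 0 < r ∧ r ≤ 1 ∧ 0 < ε ∧ ∀ W : CBall (boundary Q), W.radius ≤ r →
      ∀ (S : Finset (Fin (d + 1) → ℤ)) (g : (Fin (d + 1) → ℤ) → ℝ), (∀ x, 0 ≤ g x) →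
      ∃ w : boundary Q, dist w W.center ≤ (1 - α) * W.radius ∧
        (∀ u : Fin (d + 1) → ℤ, u ≠ 0 → ⟪intVec u, formOp Q (intVec u)⟫ = 0 →
          supNorm (intVec u) ≤ ε / W.radius → ∀ z : boundary Q, dist z w ≤ α * W.radius →
          α * W.radius ≤ ‖radial (intVec u) - (z : Space d)‖) ∧
        ∑ x ∈ S with ‖radial (intVec x) - (w : Space d)‖ ≤ 3 * α * W.radius, g x ≤
          1 / 2 * ∑ x ∈ S with ‖radial (intVec x) - (W.center : Space d)‖ ≤ 2 * W.radius, g x := by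
  obtain ⟨r, hr0, hr1, hmove⟩ := exists_two_moves hd (formOp Q) (inner_formOp_comm Q)
    (formOp_injective hQ) hα0 hα
  obtain ⟨ε, hε, horth⟩ := exists_isotropic_orthogonal Q
  have hα8 : α ≤ 1 / 8 := by
    have hc := (cPi_spec d).1
    refine hα.trans ?_
    gcongr
    nlinarith
  refine ⟨r, ε, hr0, hr1, hε, fun W hW S g hg => ?_⟩
  set ρ := W.radius with hρ
  have hρ0 : 0 < ρ := W.radius_pos
  set v : Space d := (W.center : Space d) with hv
  obtain ⟨hv0, hvc⟩ := (mem_boundary_iff Q v).1 W.center.2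
  let U : Set (Space d) := {a | ∃ u : Fin (d + 1) → ℤ, u ≠ 0 ∧
    ⟪intVec u, formOp Q (intVec u)⟫ = 0 ∧ supNorm (intVec u) ≤ ε / ρ ∧
    ‖radial (intVec u) - v‖ ≤ 2 * ρ ∧ radial (intVec u) = a}
  obtain ⟨w, hw01, hw⟩ := hmove v hvc hv0 ρ hρ0 hW U
    (by rintro _ ⟨u, hu, -, -, -, rfl⟩; exact radial_mem_cube (intVec_ne_zero hu))
    (by
      rintro _ ⟨u, -, hu1, hu2, hu3, rfl⟩ _ ⟨u', -, hu1', hu2', hu3', rfl⟩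
      exact horth v ρ hρ0 u u' hu1 hu1' hu2 hu2' hu3 hu3')
    (by rintro _ ⟨u, -, -, -, hu3, rfl⟩; exact hu3)
  have hgood : ∀ i, (∀ u : Fin (d + 1) → ℤ, u ≠ 0 → ⟪intVec u, formOp Q (intVec u)⟫ = 0 →
      supNorm (intVec u) ≤ ε / ρ → ∀ z : boundary Q, ‖(z : Space d) - w i‖ ≤ α * ρ →
      α * ρ ≤ ‖radial (intVec u) - z‖) := by
    intro i u hu0 hu1 hu2 z hz
    obtain ⟨-, -, hwv, hwz⟩ := hw i
    have hzc := ((mem_boundary_iff Q z).1 z.2).2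
    by_cases h : ‖radial (intVec u) - v‖ ≤ 2 * ρ
    · exact hwz z hzc hz _ ⟨u, hu0, hu1, hu2, h, rfl⟩
    -- A vector farther than 2ρ from v is more than ρ away from z, which lies within ρ of v.
    · have h1 := norm_sub_le_norm_sub_add_norm_sub (z : Space d) (w i) v
      have h2 := norm_sub_le_norm_sub_add_norm_sub (radial (intVec u)) (z : Space d) v
      nlinarith
  -- The two balls of radius 3αρ are disjoint and lie in the ball of radius 2ρ about v, so they
  -- cannot both carry more than half of its weight.
  have hsum : ∃ i, ∑ x ∈ S with ‖radial (intVec x) - w i‖ ≤ 3 * α * ρ, g x ≤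
      1 / 2 * ∑ x ∈ S with ‖radial (intVec x) - v‖ ≤ 2 * ρ, g x := by
    have hdisj : Disjoint (S.filter fun x => ‖radial (intVec x) - w 0‖ ≤ 3 * α * ρ)
        (S.filter fun x => ‖radial (intVec x) - w 1‖ ≤ 3 * α * ρ) := by
      refine Finset.disjoint_filter.2 fun x _ h0 h1 => ?_
      have := norm_sub_le_norm_sub_add_norm_sub (w 0) (radial (intVec x)) (w 1)
      rw [norm_sub_rev (w 0) (radial (intVec x))] at this
      linarith
    have hsub : ∀ i, S.filter (fun x => ‖radial (intVec x) - w i‖ ≤ 3 * α * ρ) ⊆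
        S.filter fun x => ‖radial (intVec x) - v‖ ≤ 2 * ρ := by
      intro i
      refine Finset.monotone_filter_right S fun x _ hx => ?_
      have h1 := norm_sub_le_norm_sub_add_norm_sub (radial (intVec x)) (w i) v
      have h2 := (hw i).2.2.1
      nlinarith
    have h := Finset.sum_le_sum_of_subset_of_nonneg (Finset.union_subset (hsub 0) (hsub 1))
      (f := g) fun x _ _ => hg x
    rw [Finset.sum_union hdisj] at h
    by_contra! hcon
    linarith [hcon 0, hcon 1]
  obtain ⟨i, hi⟩ := hsum
  refine ⟨⟨w i, (mem_boundary_iff Q _).2 ⟨(hw i).2.1, (hw i).1⟩⟩, ?_, ?_, hi⟩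
  · rw [Subtype.dist_eq, dist_eq_norm]
    exact (hw i).2.2.1
  · intro u hu0 hu1 hu2 z hz
    rw [Subtype.dist_eq, dist_eq_norm] at hz
    exact hgood i u hu0 hu1 hu2 z hz

/-! ### Avoidance and potential along a play -/

/-- Go back to the stage where u first became low enough to be avoided. Either the height had just
failed the test, so h u * ρ n > ε one round earlier, or this is the first small ball, whose radius
is at least min (ρ 0) (γ r). -/
theorem le_mul_norm_of_play {ι E : Type*} [SeminormedAddCommGroup E] {h : ι → ℝ} {p : ι → E}
    (hh : ∀ u, 1 ≤ h u) {A : ℕ → Set E} (hA : ∀ n, A (n + 1) ⊆ A n) {ρ : ℕ → ℝ}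
    {r ε α γ c : ℝ} (hα : 0 < α) (hγ : 0 < γ) (hρ0 : ∀ n, 0 < ρ n)
    (hρ : ∀ n, γ * ρ n ≤ ρ (n + 1))
    (havoid : ∀ n, ρ n ≤ r → ∀ u, h u ≤ ε / ρ n → ∀ z ∈ A n, α * ρ n ≤ ‖p u - z‖)
    (hc1 : c ≤ α * min (ρ 0) (γ * r)) (hc2 : c ≤ α * γ * ε) (n : ℕ) (hn : ρ n ≤ r) (u : ι)
    (hu : h u ≤ ε / ρ n) (z : E) (hz : z ∈ A n) : c ≤ h u * ‖p u - z‖ := by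
  have hfirst : ∀ n, ρ n ≤ r → min (ρ 0) (γ * r) ≤ ρ n → h u ≤ ε / ρ n → z ∈ A n →
      c ≤ h u * ‖p u - z‖ := by
    intro n hn hmin hu hz
    calc c ≤ 1 * (α * ρ n) := by rw [one_mul]; exact hc1.trans (by gcongr)
      _ ≤ _ := mul_le_mul (hh u) (havoid n hn u hu z hz) (mul_pos hα (hρ0 n)).le
        (zero_le_one.trans (hh u))
  induction n with
  | zero => exact hfirst 0 hn (min_le_left _ _) hu hz
  | succ n ih =>
    rcases le_or_gt (ρ n) r with hn' | hn'
    · rcases le_or_gt (h u) (ε / ρ n) with hu' | hu'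
      · exact ih hn' hu' (hA n hz)
      · rw [div_lt_iff₀ (hρ0 n)] at hu'
        have hu0 : 0 < h u := one_pos.trans_le (hh u)
        calc c ≤ α * γ * ε := hc2
          _ ≤ α * γ * (h u * ρ n) := by gcongr
          _ = h u * (α * (γ * ρ n)) := by ring
          _ ≤ h u * (α * ρ (n + 1)) := by gcongr; exact hρ n
          _ ≤ _ := by gcongr; exact havoid _ hn u hu z hz
    · refine hfirst _ hn ((min_le_right _ _).trans ?_) hu hz
      exact (by gcongr : γ * r ≤ γ * ρ n).trans (hρ n)

-- Old points lose half their weight by the move and gain a factor at most 3/2 from the shrinking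
-- radius. New points have height above e / ρ, so each weighs at most (γ e)^(-s).
open Classical in
theorem sum_rpow_le_of_step {ι : Type*} {h : ι → ℝ} {S S' : Finset ι}
    (hh : ∀ x ∈ S', 0 < h x) (hh' : ∀ x ∈ S, 0 < h x)
    {ρ ρ' γ e s P : ℝ} {M : ℕ} (hρ : 0 < ρ) (hγ : 0 < γ) (he : 0 < e) (hs : 0 < s)
    (hρρ' : γ * ρ ≤ ρ') (hγs : γ ^ (-s) ≤ 3 / 2)
    (hold : (S'.filter fun x => h x ≤ e / ρ) ⊆ S)
    (hP : ∑ x ∈ S, (ρ * h x) ^ (-s) ≤ 1 / 2 * P)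
    (hnew : (S'.filter fun x => ¬ h x ≤ e / ρ).card ≤ M) :
    ∑ x ∈ S', (ρ' * h x) ^ (-s) ≤ 3 / 4 * P + M * (γ * e) ^ (-s) := by
  rw [← Finset.sum_filter_add_sum_filter_not S' fun x => h x ≤ e / ρ]
  apply add_le_add
  · have hnn : ∀ x ∈ S, 0 ≤ (ρ * h x) ^ (-s) := fun x hx =>
      Real.rpow_nonneg (mul_pos hρ (hh' x hx)).le _
    calc ∑ x ∈ S' with h x ≤ e / ρ, (ρ' * h x) ^ (-s)
        ≤ ∑ x ∈ S' with h x ≤ e / ρ, 3 / 2 * (ρ * h x) ^ (-s) := by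
          refine Finset.sum_le_sum fun x hx => ?_
          have hx0 := hh x (Finset.mem_filter.1 hx).1
          calc (ρ' * h x) ^ (-s) ≤ (γ * (ρ * h x)) ^ (-s) := by
                refine Real.rpow_le_rpow_of_nonpos (by positivity) ?_ (by linarith)
                rw [← mul_assoc]
                gcongr
            _ = γ ^ (-s) * (ρ * h x) ^ (-s) := Real.mul_rpow hγ.le (by positivity)
            _ ≤ _ := by gcongr
      _ ≤ ∑ x ∈ S, 3 / 2 * (ρ * h x) ^ (-s) :=
          Finset.sum_le_sum_of_subset_of_nonneg hold fun x hx _ =>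
            mul_nonneg (by norm_num) (hnn x hx)
      _ = 3 / 2 * ∑ x ∈ S, (ρ * h x) ^ (-s) := by rw [Finset.mul_sum]
      _ ≤ _ := by linarith
  · have hpow : 0 ≤ (γ * e) ^ (-s) := Real.rpow_nonneg (by positivity) _
    calc ∑ x ∈ S' with ¬ h x ≤ e / ρ, (ρ' * h x) ^ (-s)
        ≤ ∑ x ∈ S' with ¬ h x ≤ e / ρ, (γ * e) ^ (-s) := by
          refine Finset.sum_le_sum fun x hx => ?_
          obtain ⟨hx1, hx2⟩ := Finset.mem_filter.1 hx
          have hx0 := hh x hx1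
          rw [not_le, div_lt_iff₀ hρ] at hx2
          refine Real.rpow_le_rpow_of_nonpos (by positivity) ?_ (by linarith)
          calc γ * e ≤ γ * (h x * ρ) := by gcongr
            _ = γ * ρ * h x := by ring
            _ ≤ _ := by gcongr
      _ = (S'.filter fun x => ¬ h x ≤ e / ρ).card * (γ * e) ^ (-s) := by
          rw [Finset.sum_const, nsmul_eq_mul]
      _ ≤ _ := by gcongr

/-- 4E is the fixed point of Φ ↦ (3/4)Φ + E; D bounds Φ when the radius first drops to r. -/
theorem le_max_of_contracting {ρ Φ : ℕ → ℝ} {r γ D E : ℝ} (hγ : 0 < γ)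
    (hρ : ∀ n, γ * ρ n ≤ ρ (n + 1))
    (hD : ∀ n, ρ n ≤ r → min (ρ 0) (γ * r) ≤ ρ n → Φ n ≤ D)
    (hE : ∀ n, ρ n ≤ r → Φ (n + 1) ≤ 3 / 4 * Φ n + E) (n : ℕ) (hn : ρ n ≤ r) :
    Φ n ≤ max D (4 * E) := by
  induction n with
  | zero => exact (hD 0 hn (min_le_left _ _)).trans (le_max_left _ _)
  | succ n ih =>
    rcases le_or_gt (ρ n) r with hn' | hn'
    · have h1 := ih hn'
      have h2 := hE n hn'
      have h3 := le_max_right D (4 * E)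
      linarith
    · refine (hD _ hn ((min_le_right _ _).trans ?_)).trans (le_max_left _ _)
      exact (by gcongr : γ * r ≤ γ * ρ n).trans (hρ n)

theorem exists_rpow_neg_le {γ : ℝ} (h0 : 0 < γ) (h1 : γ < 1) : ∃ s : ℝ, 0 < s ∧ γ ^ (-s) ≤ 3 / 2 := by
  have hlog : Real.log γ < 0 := Real.log_neg h0 h1
  have hlog2 : 0 < Real.log (3 / 2) := Real.log_pos (by norm_num)
  refine ⟨-(Real.log (3 / 2) / Real.log γ), neg_pos.2 (div_neg_of_pos_of_neg hlog2 hlog), ?_⟩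
  rw [neg_neg, Real.rpow_def_of_pos h0, mul_div_cancel₀ _ hlog.ne, Real.exp_log (by norm_num)]

theorem exists_le_and_lt_succ {ρ : ℕ → ℝ} {α t : ℝ} (hα0 : 0 < α) (hα1 : α < 1) (ht : 0 < t)
    (hρ : ∀ n, ρ (n + 1) ≤ α * ρ n) (ht0 : t ≤ ρ 0) : ∃ n, t ≤ ρ n ∧ ρ (n + 1) < t := by
  by_contra! hcon
  have hall : ∀ n, t ≤ ρ n := fun n => Nat.rec ht0 hcon n
  have hgeom : ∀ n, ρ n ≤ α ^ n * ρ 0 := by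
    intro n
    induction n with
    | zero => simp
    | succ n ih =>
      refine (hρ n).trans ?_
      rw [pow_succ', mul_assoc]
      gcongr
  have hρ0 : 0 < ρ 0 := ht.trans_le ht0
  obtain ⟨n, hn⟩ := exists_pow_lt_of_lt_one (div_pos ht hρ0) hα1
  rw [lt_div_iff₀ hρ0] at hn
  linarith [hall n, hgeom n]

theorem closedBall_subset_of_dist_le {M : Type*} [MetricSpace M] {x y : M} {α ρ : ℝ}
    (h : dist x y ≤ (1 - α) * ρ) : Metric.closedBall x (α * ρ) ⊆ Metric.closedBall y ρ :=
  Metric.closedBall_subset_closedBall' (by linarith)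

/-- The nonzero integer points of height at most `T` of the variety `Q = m`. -/
noncomputable def lowPoints (Q : QuadraticForm ℚ (Fin (d + 1) → ℚ)) (m : ℚ) (T : ℝ) :
    Finset (Fin (d + 1) → ℤ) :=
  ((finite_intVec_le T).subset fun _ hx => hx.2.2 :
    {x | x ∈ intPoints Q m ∧ x ≠ 0 ∧ supNorm (intVec x) ≤ T}.Finite).toFinset

theorem mem_lowPoints {Q : QuadraticForm ℚ (Fin (d + 1) → ℚ)} {m : ℚ} {T : ℝ}
    {x : Fin (d + 1) → ℤ} :
    x ∈ lowPoints Q m T ↔ x ∈ intPoints Q m ∧ x ≠ 0 ∧ supNorm (intVec x) ≤ T := by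
  simp only [lowPoints, Set.Finite.mem_toFinset, Set.mem_ofPred_eq]

open Classical in
theorem sum_lowPoints_le (Q : QuadraticForm ℚ (Fin (d + 1) → ℚ)) (m : ℚ) {ρ₀ ρ e s : ℝ}
    (p : (Fin (d + 1) → ℤ) → Prop) (hρ₀ : 0 < ρ₀) (hρ : ρ₀ ≤ ρ) (he : 0 < e) (hs : 0 < s) :
    ∑ x ∈ lowPoints Q m (e / ρ) with p x, (ρ * supNorm (intVec x)) ^ (-s) ≤
      (lowPoints Q m (e / ρ₀)).card * ρ₀ ^ (-s) := by
  rw [← nsmul_eq_mul, ← Finset.sum_const]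
  calc _ ≤ ∑ x ∈ lowPoints Q m (e / ρ) with p x, ρ₀ ^ (-s) := by
        refine Finset.sum_le_sum fun x hx => ?_
        have h1 := one_le_supNorm_intVec (mem_lowPoints.1 (Finset.mem_filter.1 hx).1).2.1
        refine Real.rpow_le_rpow_of_nonpos hρ₀ ?_ (by linarith)
        nlinarith
    _ ≤ _ := by
        refine Finset.sum_le_sum_of_subset_of_nonneg (fun x hx => ?_)
          fun _ _ _ => Real.rpow_nonneg hρ₀.le _
        obtain ⟨h1, h2, h3⟩ := mem_lowPoints.1 (Finset.mem_filter.1 hx).1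
        exact mem_lowPoints.2 ⟨h1, h2, h3.trans (by gcongr)⟩

open Classical in
/-- The point caught by a play is badly approximable, if the play avoids isotropic vectors and
every move of Player A halves the weight of the dangerous integer points. -/
theorem exists_pos_le_of_play (Q : QuadraticForm ℚ (Fin (d + 1) → ℚ)) (m : ℚ)
    {r α γ e δ s : ℝ} (hr : 0 < r) (hα0 : 0 < α) (hα1 : α ≤ 1 / 8) (hγ0 : 0 < γ) (he : 0 < e)
    (hδ : 0 < δ) (hs : 0 < s) (hγs : γ ^ (-s) ≤ 3 / 2) {ρ : ℕ → ℝ} {v w : ℕ → Space d}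
    (hρ0 : ∀ n, 0 < ρ n) (hρ1 : ∀ n, γ * ρ n ≤ ρ (n + 1)) (hρ2 : ∀ n, ρ (n + 1) ≤ α * ρ n)
    (hvw : ∀ n, ‖v (n + 1) - w n‖ ≤ α * ρ n)
    (hsep : ∀ n, ρ n ≤ r → ∀ x ∈ intPoints Q m, x ≠ 0 → ∀ y ∈ intPoints Q m, y ≠ 0 →
        ‖radial (intVec x) - v (n + 1)‖ ≤ 2 * ρ (n + 1) →
        ‖radial (intVec y) - v (n + 1)‖ ≤ 2 * ρ (n + 1) →
        supNorm (intVec x) ≤ e / ρ (n + 1) → supNorm (intVec y) ≤ supNorm (intVec x) →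
        supNorm (intVec x) ≤ (1 + δ) * supNorm (intVec y) → x = y)
    (hhalf : ∀ n, ρ n ≤ r →
      ∑ x ∈ lowPoints Q m (e / ρ n) with ‖radial (intVec x) - w n‖ ≤ 3 * α * ρ n,
        (ρ n * supNorm (intVec x)) ^ (-s) ≤
      1 / 2 * ∑ x ∈ lowPoints Q m (e / ρ n) with ‖radial (intVec x) - v n‖ ≤ 2 * ρ n,
        (ρ n * supNorm (intVec x)) ^ (-s)) :
    ∃ c : ℝ, 0 < c ∧ ∀ z : Space d, (∀ n, ‖z - v n‖ ≤ ρ n) → ∀ x ∈ intPoints Q m, x ≠ 0 →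
      c / supNorm (intVec x) ≤ ‖radial (intVec x) - z‖ := by
  -- New heights in a round span a factor at most γ⁻¹ < (1+δ)^M, so there are at most M of them.
  obtain ⟨M, hM⟩ := pow_unbounded_of_one_lt γ⁻¹ (by linarith : 1 < 1 + δ)
  set S : ℕ → Finset (Fin (d + 1) → ℤ) := fun n =>
    (lowPoints Q m (e / ρ n)).filter fun x => ‖radial (intVec x) - v n‖ ≤ 2 * ρ n with hS
  set Φ : ℕ → ℝ := fun n => ∑ x ∈ S n, (ρ n * supNorm (intVec x)) ^ (-s) with hΦ
  have hpos : ∀ n, ∀ x ∈ lowPoints Q m (e / ρ n), 0 < supNorm (intVec x) := fun n x hx =>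
    supNorm_pos (intVec_ne_zero (mem_lowPoints.1 hx).2.1)
  have hρmin : 0 < min (ρ 0) (γ * r) := lt_min (hρ0 0) (by positivity)
  obtain ⟨Λ, hΛ⟩ : ∃ Λ, ∀ n, ρ n ≤ r → Φ n ≤ Λ := by
    refine ⟨_, le_max_of_contracting hγ0 hρ1
      (fun n _ hn => sum_lowPoints_le Q m _ hρmin hn he hs)
      (E := M * (γ * e) ^ (-s)) fun n hn => ?_⟩
    refine sum_rpow_le_of_step
      (S := (lowPoints Q m (e / ρ n)).filter fun x => ‖radial (intVec x) - w n‖ ≤ 3 * α * ρ n)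
      (fun x hx => hpos (n + 1) x (Finset.mem_filter.1 hx).1)
      (fun x hx => hpos n x (Finset.mem_filter.1 hx).1) (hρ0 n) hγ0 he hs (hρ1 n) hγs ?_
      (hhalf n hn) ?_
    -- Origin of the 3α: 2ρ (n+1) ≤ 2αρ n, and v (n+1) is within αρ n of w n.
    · intro x hx
      obtain ⟨hx1, hx2⟩ := Finset.mem_filter.1 hx
      obtain ⟨hx3, hx4⟩ := Finset.mem_filter.1 hx1
      obtain ⟨hx5, hx6, -⟩ := mem_lowPoints.1 hx3
      refine Finset.mem_filter.2 ⟨mem_lowPoints.2 ⟨hx5, hx6, hx2⟩, ?_⟩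
      have h1 := norm_sub_le_norm_sub_add_norm_sub (radial (intVec x)) (v (n + 1)) (w n)
      have h2 := hvw n
      have h3 := hρ2 n
      linarith
    · refine card_le_of_separated (h := fun x => supNorm (intVec x)) (a := e / ρ n) hδ M _ ?_ ?_
      · intro x hx
        obtain ⟨hx1, hx2⟩ := Finset.mem_filter.1 hx
        obtain ⟨-, -, hx3⟩ := mem_lowPoints.1 (Finset.mem_filter.1 hx1).1
        have h0 := hρ0 n
        refine ⟨not_le.1 hx2, hx3.trans ?_⟩
        calc e / ρ (n + 1) ≤ e / (γ * ρ n) := by gcongr; exact hρ1 n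
          _ = e / ρ n * γ⁻¹ := by field_simp
          _ ≤ _ := by gcongr
      · intro x hx y hy hyx hxy
        obtain ⟨hx1, hx2⟩ := Finset.mem_filter.1 (Finset.mem_filter.1 hx).1
        obtain ⟨hy1, hy2⟩ := Finset.mem_filter.1 (Finset.mem_filter.1 hy).1
        obtain ⟨hx3, hx4, hx5⟩ := mem_lowPoints.1 hx1
        obtain ⟨hy3, hy4, -⟩ := mem_lowPoints.1 hy1
        exact hsep n hn x hx3 hx4 y hy3 hy4 hx2 hy2 hx5 hyx hxy
  have hΛ1 : 0 < max Λ 0 + 1 := by positivity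
  -- b is chosen so that a single point with ρ n * h(x) ≤ b already outweighs the bound Λ.
  obtain ⟨b, hb0, hbe, hbr, hbρ, hbΛ⟩ : ∃ b : ℝ, 0 < b ∧ b ≤ e ∧ b ≤ r ∧ γ * b ≤ ρ 0 ∧
      Λ < b ^ (-s) := by
    refine ⟨min (min e r) (min (ρ 0 / γ) ((max Λ 0 + 1) ^ (-(1 / s)))), ?_,
      (min_le_left _ _).trans (min_le_left _ _), (min_le_left _ _).trans (min_le_right _ _),
      ?_, ?_⟩
    · exact lt_min (lt_min he hr) (lt_min (div_pos (hρ0 0) hγ0) (Real.rpow_pos_of_pos hΛ1 _))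
    · rw [mul_comm, ← le_div_iff₀ hγ0]
      exact (min_le_right _ _).trans (min_le_left _ _)
    · refine lt_of_lt_of_le ?_ (Real.rpow_le_rpow_of_nonpos (lt_min (lt_min he hr)
        (lt_min (div_pos (hρ0 0) hγ0) (Real.rpow_pos_of_pos hΛ1 _)))
        ((min_le_right _ _).trans (min_le_right _ _)) (by linarith))
      rw [← Real.rpow_mul hΛ1.le, neg_mul_neg, one_div_mul_cancel hs.ne', Real.rpow_one]
      linarith [le_max_left Λ 0]
  refine ⟨γ * b, by positivity, fun z hz x hx hx0 => ?_⟩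
  by_contra! hcon
  have hX1 := one_le_supNorm_intVec hx0
  have hX0 : 0 < supNorm (intVec x) := by linarith
  have ht0 : 0 < γ * b / supNorm (intVec x) := by positivity
  have ht1 : γ * b / supNorm (intVec x) ≤ γ * b := div_le_self (by positivity) hX1
  -- The stage whose radius matches the approximation γ b / h(x): then x threatens the n-th ball and
  -- ρ n * h(x) ≤ b.
  obtain ⟨n, hn1, hn2⟩ := exists_le_and_lt_succ hα0 (by linarith) ht0 hρ2 (ht1.trans hbρ)
  have hn3 : ρ n * supNorm (intVec x) ≤ b := by
    have h1 := (hρ1 n).trans hn2.le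
    rw [mul_div_assoc] at h1
    have h2 := le_of_mul_le_mul_left h1 hγ0
    rwa [le_div_iff₀ hX0] at h2
  have hnr : ρ n ≤ r := by
    have := hρ0 n
    nlinarith
  have hxS : x ∈ S n := by
    refine Finset.mem_filter.2 ⟨mem_lowPoints.2 ⟨hx, hx0, ?_⟩, ?_⟩
    · rw [le_div_iff₀ (hρ0 n), mul_comm]
      linarith
    · have h1 := norm_sub_le_norm_sub_add_norm_sub (radial (intVec x)) z (v n)
      have h2 := hz n
      linarith
  have h1 : (ρ n * supNorm (intVec x)) ^ (-s) ≤ Φ n :=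
    Finset.single_le_sum (f := fun x => (ρ n * supNorm (intVec x)) ^ (-s))
      (fun y _ => Real.rpow_nonneg (mul_nonneg (hρ0 n).le (supNorm_nonneg _)) _) hxS
  have h2 : b ^ (-s) ≤ (ρ n * supNorm (intVec x)) ^ (-s) :=
    Real.rpow_le_rpow_of_nonpos (mul_pos (hρ0 n) hX0) hn3 (by linarith)
  linarith [hΛ n hnr]

/-! ### The winning strategy -/

theorem isGameWinning_BA (hd : 2 ≤ d) {Q : QuadraticForm ℚ (Fin (d + 1) → ℚ)}
    (hQ : (QuadraticMap.associated (R := ℚ) Q).Nondegenerate) (m : ℚ) {α β : ℝ} (hα0 : 0 < α)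
    (hα : α ≤ 1 / (8 * cPi d ^ 2)) (hβ0 : 0 < β) (hβ1 : β < 1) {rule : ℝ → ℝ → ℝ → Prop}
    (hrule : ∀ ρ, 0 < ρ → rule α ρ (α * ρ))
    (hrule' : ∀ ρ ρ', 0 < ρ → rule β ρ ρ' → β * ρ ≤ ρ' ∧ ρ' ≤ ρ) :
    IsGameWinning rule α β (BA Q (fun t => t⁻¹) (intPoints Q m)) := by
  classical
  have hα8 : α ≤ 1 / 8 := by
    have hc := (cPi_spec d).1
    refine hα.trans ?_
    gcongr
    nlinarith
  obtain ⟨r, ε, hr0, hr1, hε, hmove⟩ := exists_avoiding_move hd hQ hα0 hα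
  have hγ0 : 0 < α * β := by positivity
  have hγ1 : α * β < 1 := by nlinarith
  obtain ⟨s, hs, hγs⟩ := exists_rpow_neg_le hγ0 hγ1
  -- The avoidance constant, and with it δ and e, depends on the first ball, which the strategy can
  -- see.
  let c : CBall (boundary Q) → ℝ := fun W =>
    min (α * min W.radius (α * β * r)) (α * (α * β) * ε)
  have hc0 : ∀ W, 0 < c W := fun W => by
    have := W.radius_pos
    positivity
  choose δ e hδ he hsep using fun W : CBall (boundary Q) =>
    exists_separation Q m hε (hc0 W) (one_le_inv₀ hγ0 |>.2 hγ1.le)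
  choose F hF1 hF2 hF3 using fun (W₀ W : CBall (boundary Q)) (h : W.radius ≤ r) =>
    hmove W h (lowPoints Q m (e W₀ / W.radius))
      (fun x => (W.radius * supNorm (intVec x)) ^ (-s))
      (fun x => Real.rpow_nonneg (mul_nonneg W.radius_pos.le (supNorm_nonneg _)) _)
  -- While the radius exceeds r, Player A just shrinks concentrically.
  let ctr : CBall (boundary Q) → CBall (boundary Q) → boundary Q := fun W₀ W =>
    if h : W.radius ≤ r then F W₀ W h else W.center
  have hctr : ∀ W₀ W, dist (ctr W₀ W) W.center ≤ (1 - α) * W.radius := by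
    intro W₀ W
    have := W.radius_pos
    by_cases h : W.radius ≤ r
    · simpa only [ctr, dif_pos h] using hF1 W₀ W h
    · simp only [ctr, dif_neg h, dist_self]
      exact mul_nonneg (by linarith) this.le
  let σ : Strategy (boundary Q) := fun n b =>
    ⟨ctr (b 0) (b (Fin.last n)), α * (b (Fin.last n)).radius,
      mul_pos hα0 (b (Fin.last n)).radius_pos⟩
  refine ⟨σ, fun B => ?_⟩
  have hσc : ∀ n, (σ.reply B n).carrier =
      Metric.closedBall (ctr (B 0) (B n)) (α * (B n).radius) := fun n => rfl
  have hsubA : ∀ n, (σ.reply B n).carrier ⊆ (B n).carrier := fun n => by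
    rw [hσc]
    exact closedBall_subset_of_dist_le (hctr _ _)
  refine ⟨fun n _ => ⟨hsubA n, hrule _ (B n).radius_pos⟩, fun hB z hz => ?_⟩
  have hρ : ∀ n, β * (α * (B n).radius) ≤ (B (n + 1)).radius ∧
      (B (n + 1)).radius ≤ α * (B n).radius := fun n =>
    hrule' _ _ (mul_pos hα0 (B n).radius_pos) (hB n).2
  have hρ1 : ∀ n, α * β * (B n).radius ≤ (B (n + 1)).radius := fun n => by
    linarith [(hρ n).1]
  have hmem : ∀ n, (B (n + 1)).center ∈ (σ.reply B n).carrier := fun n =>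
    (hB n).1 (Metric.mem_closedBall_self (B (n + 1)).radius_pos.le)
  have hctr_eq : ∀ n (h : (B n).radius ≤ r), ctr (B 0) (B n) = F (B 0) (B n) h := fun n h => by
    simp only [ctr, dif_pos h]
  have havoid : ∀ n, (B n).radius ≤ r → ∀ u : Fin (d + 1) → ℤ, u ≠ 0 →
      ⟪intVec u, formOp Q (intVec u)⟫ = 0 → supNorm (intVec u) ≤ ε / (B n).radius →
      c (B 0) ≤ supNorm (intVec u) * ‖radial (intVec u) - ((B (n + 1)).center : Space d)‖ := by
    intro n hn u hu0 hu1 hu2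
    refine le_mul_norm_of_play
      (ι := {u : Fin (d + 1) → ℤ // u ≠ 0 ∧ ⟪intVec u, formOp Q (intVec u)⟫ = 0})
      (h := fun u => supNorm (intVec u.1)) (p := fun u => radial (intVec u.1))
      (fun u => one_le_supNorm_intVec u.2.1)
      (A := fun n => Subtype.val '' (σ.reply B n).carrier)
      (fun n => Set.image_mono ((hsubA (n + 1)).trans (hB n).1)) hα0 hγ0
      (fun n => (B n).radius_pos) hρ1 ?_ (min_le_left _ _) (min_le_right _ _) n hn
      ⟨u, hu0, hu1⟩ hu2 _ ⟨_, hmem n, rfl⟩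
    rintro n hn ⟨u, hu0, hu1⟩ hu2 _ ⟨y, hy, rfl⟩
    rw [hσc, hctr_eq n hn] at hy
    exact hF2 (B 0) (B n) hn u hu0 hu1 hu2 y hy
  obtain ⟨c₀, hc₀, hfin⟩ := exists_pos_le_of_play Q m hr0 hα0 hα8 hγ0 (he (B 0)) (hδ (B 0)) hs hγs
    (ρ := fun n => (B n).radius) (v := fun n => ((B n).center : Space d))
    (w := fun n => (ctr (B 0) (B n) : Space d)) (fun n => (B n).radius_pos) hρ1
    (fun n => (hρ n).2)
    (fun n => by
      have := hmem n
      rw [hσc, Metric.mem_closedBall, Subtype.dist_eq, dist_eq_norm] at this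
      exact this)
    -- Separation holds at the next centre: it lies in A's n-th ball, so it avoids isotropic vectors
    -- of height up to ε / ρ n; the ratio of radii is at most K = γ⁻¹.
    (fun n hn => hsep (B 0) _ ((mem_boundary_iff Q _).1 (B (n + 1)).center.2).2 (B n).radius _
      (B n).radius_pos (hn.trans hr1) (B (n + 1)).radius_pos
      (by rw [inv_mul_eq_div, le_div_iff₀ hγ0, mul_comm]; exact hρ1 n) (havoid n hn))
    (fun n hn => by
      simp only [hctr_eq n hn]
      exact hF3 (B 0) (B n) hn)
  -- The factor d + 1 passes from the Euclidean norm to the sup norm.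
  refine ⟨c₀ / (d + 1), by positivity, fun x hx hx0 => ?_⟩
  have h1 := hfin z (fun n => by
    have := Set.mem_iInter.1 hz n
    rw [CBall.carrier, Metric.mem_closedBall, Subtype.dist_eq, dist_eq_norm] at this
    exact this) x hx hx0
  have h2 := h1.trans (norm_le_supNorm _)
  rw [div_mul_eq_mul_div, div_le_iff₀ (by positivity), ← div_eq_mul_inv, mul_comm]
  exact h2

theorem isStrongWinning_and_isWinning_BA (hd : 2 ≤ d) {Q : QuadraticForm ℚ (Fin (d + 1) → ℚ)}
    (hQ : (QuadraticMap.associated (R := ℚ) Q).Nondegenerate) (m : ℚ) {α : ℝ} (hα0 : 0 < α)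
    (hα : α ≤ 1 / (8 * cPi d ^ 2)) :
    IsStrongWinning α (BA Q (fun t => t⁻¹) (intPoints Q m)) ∧
      IsWinning α (BA Q (fun t => t⁻¹) (intPoints Q m)) := by
  have hα1 : α < 1 := by
    refine hα.trans_lt ?_
    have hc := (cPi_spec d).1
    rw [div_lt_one (by positivity)]
    nlinarith
  refine ⟨⟨hα0, hα1, fun β hβ0 hβ1 => ?_⟩, ⟨hα0, hα1, fun β hβ0 hβ1 => ?_⟩⟩
  · refine isGameWinning_BA hd hQ m hα0 hα hβ0 hβ1 (fun ρ hρ => ⟨le_rfl, ?_⟩) fun ρ ρ' _ h => h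
    nlinarith
  · refine isGameWinning_BA hd hQ m hα0 hα hβ0 hβ1 (fun ρ hρ => rfl) fun ρ ρ' hρ h => ?_
    rw [schmidtRule] at h
    rw [h]
    exact ⟨le_rfl, by nlinarith⟩

end BadApprox

theorem mainTheorem1 (d : ℕ) (hd : 2 ≤ d) (Q : QuadraticForm ℚ (Fin (d + 1) → ℚ))
    (hQ : (QuadraticMap.associated (R := ℚ) Q).Nondegenerate)
    (hpos : ∃ x, 0 < Q x) (hneg : ∃ x, Q x < 0) (m : ℚ) (hm : m ≠ 0) :
    (BadApprox.IsDiagonal Q →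
      BadApprox.IsStrongWinning (1 / (8 * BadApprox.cPi d ^ 2))
          (BadApprox.BA Q (fun t => t⁻¹) (BadApprox.intPoints Q m)) ∧
        BadApprox.IsWinning (1 / (8 * BadApprox.cPi d ^ 2))
          (BadApprox.BA Q (fun t => t⁻¹) (BadApprox.intPoints Q m))) ∧
    (∃ M : GL (Fin (d + 1)) ℚ, BadApprox.Diagonalizes M Q) ∧
    ∀ M : GL (Fin (d + 1)) ℚ, BadApprox.Diagonalizes M Q →
      BadApprox.IsStrongWinning (1 / (8 * BadApprox.cMat M ^ 2 * BadApprox.cPi d ^ 2))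
          (BadApprox.BA Q (fun t => t⁻¹) (BadApprox.intPoints Q m)) ∧
        BadApprox.IsWinning (1 / (8 * BadApprox.cMat M ^ 2 * BadApprox.cPi d ^ 2))
          (BadApprox.BA Q (fun t => t⁻¹) (BadApprox.intPoints Q m)) := by
  have hc := (BadApprox.cPi_spec d).1
  refine ⟨fun _ => BadApprox.isStrongWinning_and_isWinning_BA hd hQ m (by positivity) le_rfl,
    BadApprox.exists_diagonalizes Q, fun M _ => ?_⟩
  have hM := BadApprox.one_le_cMat M
  refine BadApprox.isStrongWinning_and_isWinning_BA hd hQ m (by positivity) ?_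
  have : 1 ≤ BadApprox.cMat M ^ 2 := one_le_pow₀ hM
  gcongr
  linarith
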